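/- Let $G$ be a compact Lie group whose Lie algebra $\mathfrak g$ is semisimple, and let $U$ be a finite-dimensional irreducible (smooth) unitary representation of $G$ on $\mathcal V=\mathbb C^d$. For a finite set $\Lambda$ of $N$ sites let $G$ act on $\mathcal V^{\otimes\Lambda}$ by $U(g)^{\otimes \Lambda}$. When the invariant subspace of $\mathcal V^{\otimes\Lambda}$ is nonzero, the maximally mixed invariant state (MMIS) is $\rho^\Lambda_{\mathsf{inv}}=P_{\mathsf{inv}}/\operatorname{Tr}P_{\mathsf{inv}}$, where $P_{\mathsf{inv}}$ is the orthogonal projector onto it. For $X\in\mathfrak g$ let $U(X)$ be the derivative of $U$ at the identity in the direction $X$, and let $U(X_x)$ be this operator acting on the site $x$. 1. There is a real number $c_{\mathcal V}$, depending only on $G$ and $U$, such that for every basis $(X_\alpha)$ of $\mathfrak g$ that is orthonormal with respect to the negative of the Killing form, the Casimir operator is $-\sum_\alpha U(X_\alpha)^2=c_{\mathcal V}\,\mathbb I_{\mathcal V}$, and for every $\Lambda$ with nonzero invariant subspace and all sites $x\neq y$ in $\Lambda$ $$-\operatorname{Tr}\Big[\rho^\Lambda_{\mathsf{inv}}\sum_\alpha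 U(X_{x,\alpha})\,U(X_{y,\alpha})\Big]=-\frac{c_{\mathcal V}}{N-1}.$$ Here $X_{x,\alpha}$ denotes $X_\alpha$ acting on the site $x$. If $G$ is connected and $U$ is not the trivial representation, then $c_{\mathcal V}>0$. Moreover $\operatorname{Tr}[\rho^\Lambda_{\mathsf{inv}}U(X_x)]=0$ for every site $x$ and every $X\in\mathfrak g$, so the connected correlator has the same value. It decays algebraically in $N$ and does not depend on any distance between the sites. 2. If $G$ is connected and $U$ is not trivial, the MMIS is long-range entangled in the following sense. For every depth $D\in\mathbb N$ and every range $r\in\mathbb R$ there is $\ell\in\mathbb R$ such that, whenever the set of sites $\Lambda$ is a finite metric space of diameter larger than $\ell$ with nonzero invariant subspace, $\rho^\Lambda_{\mathsf{inv}}$ is not a convex combination of projectors $|\psi\rangle\langle\psi|$ where $\psi=W\bigotimes_x\varphi_x$, the $\varphi_x$ are unit vectors and $W$ is a unitary circuit of $D$ layers. Each layer is a product of unitary gates that act on pairwise disjoint sets of sites of diameter at most $r$. (For example, $\Lambda$ is the chain $\{1,\dots,N\}$ with $N$ large.) 3. For $SU(2)$ acting on a spin-$1/2$ system $(\mathbb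 C^2)^{\otimes\Lambda}$ with $N$ even, with $\mathbf S_i$ one half of the vector of Pauli matrices on the site $i$, one has $$\operatorname{Tr}\big[\rho^\Lambda_{\mathsf{inv}}\,\mathbf S_i\cdot\mathbf S_j\big]=-\frac{3}{4(N-1)}\quad(i\ne j),\qquad \operatorname{Tr}\big[\rho^\Lambda_{\mathsf{inv}}\,S_i^a\big]=0\quad(a=1,2,3),$$ and the MMIS is long-range entangled in the sense of part 2. -/

import Mathlib

open scoped Manifold ContDiff

noncomputable section

namespace MMIS

/-! ### Spin systems: finitely many sites `Λ`, each carrying the Hilbert space `ℂ^d`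

The Hilbert space of the system is `(ℂ^d)^{⊗Λ}`, written in the product basis `|s⟩`,
`s : Λ → Fin d`; operators are matrices in that basis. -/

section System

variable {d : ℕ} {Λ : Type} [Fintype Λ] [DecidableEq Λ]

/-- Operators on `(ℂ^d)^{⊗Λ}`. -/
abbrev Op (d : ℕ) (Λ : Type) : Type := Matrix (Λ → Fin d) (Λ → Fin d) ℂ

/-- The operator `⨂_x A`, acting by the same matrix `A` on every site. -/
def onEverySite (Λ : Type) [Fintype Λ] (A : Matrix (Fin d) (Fin d) ℂ) : Op d Λ :=
  Matrix.of fun s t => ∏ x, A (s x) (t x)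

/-- The operator `A_x`, acting by `A` on the site `x` and by the identity elsewhere. -/
def onSite (x : Λ) (A : Matrix (Fin d) (Fin d) ℂ) : Op d Λ :=
  Matrix.of fun s t => if ∀ z, z ≠ x → s z = t z then A (s x) (t x) else 0

/-! ### The maximally mixed invariant state -/

variable {G : Type*} [Monoid G]

/-- The invariant (trivial, singlet) sector of `(ℂ^d)^{⊗Λ}` under `g ↦ U(g)^{⊗Λ}`. -/
def invariantSector (U : G →* Matrix.unitaryGroup (Fin d) ℂ) (Λ : Type) [Fintype Λ]
    [DecidableEq Λ] : Submodule ℂ (EuclideanSpace ℂ (Λ → Fin d)) where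
  carrier := {ψ | ∀ g, Matrix.mulVec (onEverySite Λ (U g : Matrix (Fin d) (Fin d) ℂ)) ψ.ofLp
    = ψ.ofLp}
  add_mem' := by
    intro a b ha hb g
    rw [WithLp.ofLp_add, Matrix.mulVec_add, ha g, hb g]
  zero_mem' := by
    intro g
    simp
  smul_mem' := by
    intro c a ha g
    rw [WithLp.ofLp_smul, Matrix.mulVec_smul, ha g]

/-- The maximally mixed invariant state: the orthogonal projector onto the invariant sector divided
by the dimension of that sector. It is a state when the invariant sector is nonzero. -/
def mmis (U : G →* Matrix.unitaryGroup (Fin d) ℂ) (Λ : Type) [Fintype Λ] [DecidableEq Λ] :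
    Op d Λ :=
  ((Module.finrank ℂ (invariantSector U Λ) : ℂ)⁻¹) •
    (Matrix.toEuclideanCLM (𝕜 := ℂ) (n := Λ → Fin d)).symm (invariantSector U Λ).starProjection

/-- The on-site unitary representation, as a representation on `ℂ^d`. -/
def onSiteRep (U : G →* Matrix.unitaryGroup (Fin d) ℂ) : Representation ℂ G (Fin d → ℂ) :=
  (MonoidHomClass.toMonoidHom (Matrix.toLinAlgEquiv' (R := ℂ) (n := Fin d))).comp
    ((Submonoid.subtype _).comp U)

/-! ### Short-range entangled states and their mixtures -/

/-- The operator `W` acts as the identity outside of the set of sites `S`. -/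
def ActsOn (S : Finset Λ) (W : Op d Λ) : Prop :=
  ∃ w : Matrix (S → Fin d) (S → Fin d) ℂ, ∀ s t : Λ → Fin d,
    W s t = if ∀ z, z ∉ S → s z = t z then w (fun z => s z) (fun z => t z) else 0

/-- A layer of a local unitary circuit: a product of unitary gates that act on pairwise disjoint
sets of sites, each of diameter at most `r`. -/
def IsLayer [MetricSpace Λ] (r : ℝ) (L : Op d Λ) : Prop :=
  ∃ (k : ℕ) (S : Fin k → Finset Λ) (W : Fin k → Op d Λ),
    (∀ i j, i ≠ j → Disjoint (S i) (S j)) ∧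
    (∀ i, ∀ x ∈ S i, ∀ y ∈ S i, dist x y ≤ r) ∧
    (∀ i, W i ∈ Matrix.unitaryGroup (Λ → Fin d) ℂ) ∧
    (∀ i, ActsOn (S i) (W i)) ∧
    L = (List.ofFn W).prod

/-- Unitary circuits that consist of a given number (the depth) of layers. A layer may be trivial,
so that a circuit of smaller depth is also one of larger depth. -/
def IsCircuit [MetricSpace Λ] (r : ℝ) : ℕ → Op d Λ → Prop
  | 0, W => W = 1
  | D + 1, W => ∃ L W' : Op d Λ, IsLayer r L ∧ IsCircuit r D W' ∧ W = L * W'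

/-- The product vector `⨂_x φ_x`. -/
def productVector (φ : Λ → EuclideanSpace ℂ (Fin d)) : (Λ → Fin d) → ℂ :=
  fun s => ∏ x, φ x (s x)

/-- The density matrices `|ψ⟩⟨ψ|` of the pure states `ψ` that are obtained from a normalized product
vector by a unitary circuit of depth `D` with gates of range `r`. -/
def shortRangeStates (d : ℕ) (Λ : Type) [Fintype Λ] [DecidableEq Λ] [MetricSpace Λ]
    (D : ℕ) (r : ℝ) : Set (Op d Λ) :=
  {ρ | ∃ (W : Op d Λ) (φ : Λ → EuclideanSpace ℂ (Fin d)),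
    IsCircuit r D W ∧ (∀ x, ‖φ x‖ = 1) ∧
    ρ = Matrix.vecMulVec (W.mulVec (productVector φ)) (star (W.mulVec (productVector φ)))}

/-- The maximally mixed invariant states of `U` are long-range entangled: for any fixed depth and
range, on every system of sites of sufficiently large diameter (for example the chain
`{1, …, N}` with distance `|i - j|`, for `N` large) on which the state exists, it is not a mixture
(a convex combination) of short-range entangled pure states. -/
def IsLongRangeEntangled (U : G →* Matrix.unitaryGroup (Fin d) ℂ) : Prop :=
  ∀ (D : ℕ) (r : ℝ), ∃ ℓ : ℝ, ∀ (Λ : Type) [Fintype Λ] [DecidableEq Λ] [MetricSpace Λ],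
    invariantSector U Λ ≠ ⊥ → (∃ x y : Λ, ℓ < dist x y) →
      mmis U Λ ∉ convexHull ℝ (shortRangeStates d Λ D r)

end System

/-! ### Lie groups -/

instance : ENat.LEInfty (minSmoothness ℝ 3) :=
  ⟨by
    rw [minSmoothness_of_isRCLikeNormedField]
    exact ENat.LEInfty.out⟩

section Lie

variable {m d : ℕ} {G : Type*} [TopologicalSpace G] [ChartedSpace (EuclideanSpace ℝ (Fin m)) G]
  [Group G]

/-- The on-site representation is smooth, that is, all its matrix entries are. -/
def IsSmoothRep (U : G →* Matrix.unitaryGroup (Fin d) ℂ) : Prop :=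
  ∀ i j, ContMDiff (𝓡 m) 𝓘(ℝ, ℂ) ∞ (fun g : G => (U g : Matrix (Fin d) (Fin d) ℂ) i j)

/-- The derivative at the identity `X ↦ U(X)` of the representation `U`. -/
def lieRep (U : G →* Matrix.unitaryGroup (Fin d) ℂ) (X : GroupLieAlgebra (𝓡 m) G) :
    Matrix (Fin d) (Fin d) ℂ :=
  Matrix.of fun i j =>
    (mfderiv (𝓡 m) 𝓘(ℝ, ℂ) (fun g : G => (U g : Matrix (Fin d) (Fin d) ℂ) i j) 1 X : ℂ)

/-- A basis of the Lie algebra that is orthonormal for the Killing form, in the sign convention for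
compact groups: the Killing form is negative definite, and orthonormality is with respect to its
negative. -/
def IsKillingOrthonormal [LieGroup (𝓡 m) ∞ G]
    (b : Module.Basis (Fin m) ℝ (GroupLieAlgebra (𝓡 m) G)) : Prop :=
  ∀ α β, killingForm ℝ (GroupLieAlgebra (𝓡 m) G) (b α) (b β) = if α = β then -1 else 0

/-- The Casimir operator `U(C) = -∑_α U(X_α)²` of the on-site representation. -/
def casimir (U : G →* Matrix.unitaryGroup (Fin d) ℂ)
    (b : Module.Basis (Fin m) ℝ (GroupLieAlgebra (𝓡 m) G)) : Matrix (Fin d) (Fin d) ℂ :=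
  -∑ α, lieRep U (b α) * lieRep U (b α)

end Lie

/-! ### Spin one half -/

/-- The defining representation of `SU(2)` on `ℂ²`. -/
def spinHalf :
    Matrix.specialUnitaryGroup (Fin 2) ℂ →* Matrix.unitaryGroup (Fin 2) ℂ :=
  Submonoid.inclusion Matrix.specialUnitaryGroup_le_unitaryGroup

/-- The spin-`1/2` operators: one half of the Pauli matrices. -/
def spin : Fin 3 → Matrix (Fin 2) (Fin 2) ℂ :=
  ![(1 / 2 : ℂ) • !![0, 1; 1, 0],
    (1 / 2 : ℂ) • !![0, -Complex.I; Complex.I, 0],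
    (1 / 2 : ℂ) • !![1, 0; 0, -1]]

end MMIS

end

noncomputable section

namespace MMIS

section System

variable {d : ℕ} {Λ : Type} [Fintype Λ] [DecidableEq Λ]

/-! ### Algebra of one-site operators -/

/-! Everything rests on one sum rule. Differentiating `U(γ t)^{⊗Λ} ψ = ψ` shows that the total
generator `∑ x, A_x` kills the invariant sector, hence the MMIS `ρ`. As `ρ` is also invariant under
permutations of the sites, multiplying by `A_x` and taking the trace gives `(N - 1) Tr ρ A_x A_y =
-Tr ρ (A²)_x` (`IsGenerator.trace_mmis_mul_onSite_mul_onSite`). Summed over a Killing-orthonormal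
basis, the right side becomes the Casimir, a scalar by Schur's lemma: the adjoint action consists of
Lie algebra automorphisms, so it preserves the Killing form, and the Casimir does not depend on the
orthonormal basis.

For long-range entanglement, suppose that `ρ` is a mixture of short-range entangled pure states.
Every state with nonzero weight lies in the invariant sector, so by Schur its one-site reduced state
is a multiple of the identity and the traceless `A` has mean zero in it. Once the sites are further
apart than two light cones, `⟨A_x A_y⟩ = ⟨A_x⟩⟨A_y⟩ = 0` in each such state, hence in `ρ`. The sum
rule then forces `Tr A² = 0`, which fails for a nonzero anti-Hermitian `A`
(`isLongRangeEntangled_of_generator`).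

This argument needs only curves in the group (`IsGenerator`) and a scalar commutant
(`HasScalarCommutant`), so it applies to `SU(2)` through explicit curves and matrices. -/

lemma onSite_mul_apply (x : Λ) (A : Matrix (Fin d) (Fin d) ℂ) {κ : Type*}
    (M : Matrix (Λ → Fin d) κ ℂ) (s : Λ → Fin d) (t : κ) :
    (onSite x A * M) s t = ∑ k, A (s x) k * M (Function.update s x k) t := by
  rw [Matrix.mul_apply]
  symm
  apply Finset.sum_of_injOn (fun k => Function.update s x k)
  · exact (Function.update_injective s x).injOn
  · simp
  · intro u _ hu
    rw [onSite, Matrix.of_apply, if_neg, zero_mul]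
    intro h
    refine hu ⟨u x, by simp, ?_⟩
    ext1 z
    by_cases hz : z = x
    · subst hz; simp
    · simp [hz, h z hz]
  · intro k _
    rw [onSite, Matrix.of_apply, if_pos]
    · simp
    · intro z hz; simp [hz]

lemma mul_onSite_apply (x : Λ) (A : Matrix (Fin d) (Fin d) ℂ) {κ : Type*}
    (M : Matrix κ (Λ → Fin d) ℂ) (s : κ) (t : Λ → Fin d) :
    (M * onSite x A) s t = ∑ k, M s (Function.update t x k) * A k (t x) := by
  have hT : (onSite x A).transpose = onSite x A.transpose := by
    ext s t
    simp only [onSite, Matrix.transpose_apply, Matrix.of_apply]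
    exact if_congr (forall₂_congr fun z _ => eq_comm) rfl rfl
  have := onSite_mul_apply x A.transpose M.transpose t s
  rw [← hT, ← Matrix.transpose_mul] at this
  simpa [mul_comm] using this

lemma onSite_add (x : Λ) (A B : Matrix (Fin d) (Fin d) ℂ) :
    onSite x (A + B) = onSite x A + onSite x B := by
  ext s t
  simp only [onSite, Matrix.of_apply, Matrix.add_apply]
  split_ifs <;> simp

lemma onSite_smul (x : Λ) (c : ℂ) (A : Matrix (Fin d) (Fin d) ℂ) :
    onSite x (c • A) = c • onSite x A := by
  ext s t
  simp only [onSite, Matrix.of_apply, Matrix.smul_apply]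
  split_ifs <;> simp

lemma onSite_one (x : Λ) : onSite x (1 : Matrix (Fin d) (Fin d) ℂ) = 1 := by
  ext s t
  simp only [onSite, Matrix.of_apply, Matrix.one_apply]
  by_cases h : s = t
  · simp [h]
  · rw [if_neg h]
    split_ifs with h1 h2
    · exact absurd (funext fun z => if hz : z = x then hz ▸ h2 else h1 z hz) h
    · rfl
    · rfl

lemma onSite_mul (x : Λ) (A B : Matrix (Fin d) (Fin d) ℂ) :
    onSite x A * onSite x B = onSite x (A * B) := by
  rw [← Matrix.mul_one (onSite x (A * B)), ← Matrix.mul_one (onSite x A * onSite x B),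
    Matrix.mul_assoc]
  ext s t
  have h : ∀ k, (A * B) (s x) k = ∑ l, A (s x) l * B l k := fun k => Matrix.mul_apply
  simp only [onSite_mul_apply, Function.update_self, h, Finset.mul_sum, Finset.sum_mul]
  rw [Finset.sum_comm]
  refine Finset.sum_congr rfl fun k _ => Finset.sum_congr rfl fun l _ => ?_
  rw [Function.update_idem, mul_assoc]

/-- The operators on the site `x` form a copy of the matrix algebra. -/
def onSiteLinear (x : Λ) : Matrix (Fin d) (Fin d) ℂ →ₗ[ℂ] Op d Λ where
  toFun := onSite x
  map_add' := onSite_add x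
  map_smul' := onSite_smul x

lemma onSiteLinear_apply (x : Λ) (A : Matrix (Fin d) (Fin d) ℂ) :
    onSiteLinear x A = onSite x A := rfl

lemma onEverySite_mul (A B : Matrix (Fin d) (Fin d) ℂ) :
    onEverySite Λ (A * B) = onEverySite Λ A * onEverySite Λ B := by
  ext s t
  simp only [onEverySite, Matrix.mul_apply, Matrix.of_apply]
  rw [Finset.prod_univ_sum, Fintype.piFinset_univ]
  simp only [Finset.prod_mul_distrib]

omit [DecidableEq Λ] in
lemma onEverySite_one : onEverySite Λ (1 : Matrix (Fin d) (Fin d) ℂ) = 1 := by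
  ext s t
  simp only [onEverySite, Matrix.one_apply, Matrix.of_apply, Finset.prod_ite_zero, funext_iff]
  simp

omit [DecidableEq Λ] in
lemma conjTranspose_onEverySite (A : Matrix (Fin d) (Fin d) ℂ) :
    (onEverySite Λ A).conjTranspose = onEverySite Λ A.conjTranspose := by
  ext s t
  simp [onEverySite, Matrix.conjTranspose_apply]

/-- Only the factor at `x` sees `A` or `B`; the factors at the other sites are common to both sides.
-/
lemma onSite_mul_onEverySite (x : Λ) {A B V : Matrix (Fin d) (Fin d) ℂ} (h : A * V = V * B) :
    onSite x A * onEverySite Λ V = onEverySite Λ V * onSite x B := by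
  ext s t
  rw [onSite_mul_apply, mul_onSite_apply]
  have key1 : ∀ k, onEverySite Λ V (Function.update s x k) t =
      V k (t x) * ∏ y ∈ Finset.univ.erase x, V (s y) (t y) := by
    intro k
    rw [onEverySite, Matrix.of_apply, ← Finset.mul_prod_erase _ _ (Finset.mem_univ x)]
    congr 1
    · simp
    · refine Finset.prod_congr rfl fun y hy => ?_
      simp [Finset.ne_of_mem_erase hy]
  have key2 : ∀ k, onEverySite Λ V s (Function.update t x k) =
      V (s x) k * ∏ y ∈ Finset.univ.erase x, V (s y) (t y) := by
    intro k
    rw [onEverySite, Matrix.of_apply, ← Finset.mul_prod_erase _ _ (Finset.mem_univ x)]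
    congr 1
    · simp
    · refine Finset.prod_congr rfl fun y hy => ?_
      simp [Finset.ne_of_mem_erase hy]
  have h' := congrFun (congrFun h (s x)) (t x)
  rw [Matrix.mul_apply, Matrix.mul_apply] at h'
  simp only [key1, key2, ← mul_assoc]
  rw [← Finset.sum_mul, h', Finset.sum_mul]
  exact Finset.sum_congr rfl fun k _ => by ring

/-! ### The projector onto the invariant sector -/

variable {G : Type*} [Monoid G] (U : G →* Matrix.unitaryGroup (Fin d) ℂ)

/-- The matrix of the orthogonal projector onto the invariant sector. -/
def invariantProj (Λ : Type) [Fintype Λ] [DecidableEq Λ] : Op d Λ :=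
  (Matrix.toEuclideanCLM (𝕜 := ℂ) (n := Λ → Fin d)).symm (invariantSector U Λ).starProjection

lemma mmis_eq : mmis U Λ =
    ((Module.finrank ℂ (invariantSector U Λ) : ℂ)⁻¹) • invariantProj U Λ := rfl

variable {U}

lemma invariantProj_mulVec (v : EuclideanSpace ℂ (Λ → Fin d)) :
    (invariantProj U Λ).mulVec v.ofLp = ((invariantSector U Λ).starProjection v).ofLp := by
  rw [← Matrix.ofLp_toEuclideanCLM, invariantProj, StarAlgEquiv.apply_symm_apply]

lemma invariantProj_mulVec_of_mem {v : EuclideanSpace ℂ (Λ → Fin d)}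
    (hv : v ∈ invariantSector U Λ) : (invariantProj U Λ).mulVec v.ofLp = v.ofLp := by
  rw [invariantProj_mulVec, Submodule.starProjection_eq_self_iff.2 hv]

/-- The columns of the projector lie in the invariant sector, so operators that agree there agree
after multiplication by it. -/
lemma mul_invariantProj_eq {A B : Op d Λ}
    (h : ∀ ψ ∈ invariantSector U Λ, A.mulVec ψ.ofLp = B.mulVec ψ.ofLp) :
    A * invariantProj U Λ = B * invariantProj U Λ := by
  refine Matrix.ext_of_mulVec_single fun i => ?_
  rw [← Matrix.mulVec_mulVec, ← Matrix.mulVec_mulVec]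
  have := invariantProj_mulVec (U := U) (WithLp.toLp 2 (Pi.single i (1 : ℂ)))
  rw [show (WithLp.toLp 2 (Pi.single i (1 : ℂ)) : EuclideanSpace ℂ (Λ → Fin d)).ofLp
    = Pi.single i 1 from rfl] at this
  rw [this]
  exact h _ (Submodule.starProjection_apply_mem _ _)

lemma invariantProj_conjTranspose :
    (invariantProj U Λ).conjTranspose = invariantProj U Λ := by
  rw [← Matrix.star_eq_conjTranspose, invariantProj]
  refine ((Matrix.toEuclideanCLM (𝕜 := ℂ) (n := Λ → Fin d)).symm.toStarRingEquiv.map_star' _).symm.trans ?_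
  rw [(isSelfAdjoint_starProjection (invariantSector U Λ)).star_eq]
  rfl

lemma onEverySite_mul_invariantProj (g : G) :
    onEverySite Λ (U g : Matrix (Fin d) (Fin d) ℂ) * invariantProj U Λ = invariantProj U Λ := by
  conv_rhs => rw [← Matrix.one_mul (invariantProj U Λ)]
  exact mul_invariantProj_eq fun ψ hψ => by rw [hψ g, Matrix.one_mulVec]

lemma invariantProj_mul_self :
    invariantProj U Λ * invariantProj U Λ = invariantProj U Λ := by
  conv_rhs => rw [← Matrix.one_mul (invariantProj U Λ)]
  exact mul_invariantProj_eq fun ψ hψ => by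
    rw [invariantProj_mulVec_of_mem hψ, Matrix.one_mulVec]

lemma trace_invariantProj :
    (invariantProj U Λ).trace = Module.finrank ℂ (invariantSector U Λ) := by
  have h : LinearMap.IsProj (invariantSector U Λ)
      ((invariantSector U Λ).starProjection : _ →ₗ[ℂ] _) :=
    ⟨fun x => Submodule.starProjection_apply_mem _ x,
      fun x hx => Submodule.starProjection_eq_self_iff.2 hx⟩
  rw [← h.trace, LinearMap.trace_eq_matrix_trace ℂ (EuclideanSpace.basisFun _ ℂ).toBasis]
  rfl

lemma trace_mmis (h : invariantSector U Λ ≠ ⊥) : (mmis U Λ).trace = 1 := by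
  rw [mmis_eq, Matrix.trace_smul, trace_invariantProj, smul_eq_mul, inv_mul_cancel₀]
  rw [Nat.cast_ne_zero]
  exact fun h0 => h (Submodule.finrank_eq_zero.1 h0)

omit [DecidableEq Λ] in
/-- Relabelling the sites. -/
lemma onEverySite_submatrix (σ : Equiv.Perm Λ) (A : Matrix (Fin d) (Fin d) ℂ) :
    (onEverySite Λ A).submatrix (fun s => s ∘ σ) (fun s => s ∘ σ) = onEverySite Λ A := by
  ext s t
  simp only [onEverySite, Matrix.submatrix_apply, Matrix.of_apply, Function.comp]
  exact Equiv.prod_comp σ fun x => A (s x) (t x)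

lemma onSite_submatrix (σ : Equiv.Perm Λ) (x : Λ) (A : Matrix (Fin d) (Fin d) ℂ) :
    (onSite x A).submatrix (fun s => s ∘ σ) (fun s => s ∘ σ) = onSite (σ x) A := by
  ext s t
  simp only [onSite, Matrix.submatrix_apply, Matrix.of_apply, Function.comp]
  refine if_congr ⟨fun h z hz => ?_, fun h z hz => h _ (σ.injective.ne hz)⟩ rfl rfl
  have := h (σ.symm z) (fun h' => hz (by rw [← h', Equiv.apply_symm_apply]))
  simpa using this

lemma comp_perm_mem_invariantSector (τ : Equiv.Perm Λ) {ψ : EuclideanSpace ℂ (Λ → Fin d)}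
    (hψ : ψ ∈ invariantSector U Λ) :
    (WithLp.toLp 2 (fun s => ψ.ofLp (s ∘ τ)) : EuclideanSpace ℂ (Λ → Fin d))
      ∈ invariantSector U Λ := by
  intro g
  let e : (Λ → Fin d) ≃ (Λ → Fin d) := τ.symm.arrowCongr (Equiv.refl _)
  have h := Matrix.submatrix_mulVec_equiv
    (onEverySite Λ (U g : Matrix (Fin d) (Fin d) ℂ)) (ψ.ofLp ∘ e) e e
  rw [show (onEverySite Λ (U g : Matrix (Fin d) (Fin d) ℂ)).submatrix e e = _ from
    onEverySite_submatrix τ _, Function.comp_assoc, Equiv.self_comp_symm, Function.comp_id,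
    hψ g] at h
  exact h

/-- Let `P_τ` be the relabelled projector. Permutations preserve the sector, so `P_τ P = P` for all
`τ`. The adjoint of this for `σ` gives `P P_σ = P`, and relabelling it for `σ⁻¹` by `σ` gives `P P_σ
= P_σ`. -/
lemma invariantProj_submatrix (σ : Equiv.Perm Λ) :
    (invariantProj U Λ).submatrix (fun s => s ∘ σ) (fun s => s ∘ σ) = invariantProj U Λ := by
  let e : Equiv.Perm Λ → (Λ → Fin d) ≃ (Λ → Fin d) :=
    fun τ => τ.symm.arrowCongr (Equiv.refl _)
  set P := invariantProj U Λ with hP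
  have hH : ∀ τ, (P.submatrix (e τ) (e τ)).conjTranspose = P.submatrix (e τ) (e τ) := fun τ => by
    rw [Matrix.conjTranspose_submatrix, invariantProj_conjTranspose]
  have h1 : ∀ τ, P.submatrix (e τ) (e τ) * P = P := fun τ => by
    conv_rhs => rw [← Matrix.one_mul P]
    refine mul_invariantProj_eq fun ψ hψ => ?_
    have h3 := invariantProj_mulVec_of_mem (comp_perm_mem_invariantSector τ.symm hψ)
    change Matrix.mulVec P (ψ.ofLp ∘ (e τ).symm) = ψ.ofLp ∘ (e τ).symm at h3
    rw [Matrix.submatrix_mulVec_equiv, h3, Matrix.one_mulVec, Function.comp_assoc,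
      Equiv.symm_comp_self, Function.comp_id]
  have h2 : P * P.submatrix (e σ) (e σ) = P := by
    have := congrArg Matrix.conjTranspose (h1 σ)
    rwa [Matrix.conjTranspose_mul, hH, invariantProj_conjTranspose] at this
  have h3 : (P.submatrix (e σ.symm) (e σ.symm)).submatrix (e σ) (e σ) *
      P.submatrix (e σ) (e σ) = P.submatrix (e σ) (e σ) := by
    rw [Matrix.submatrix_mul_equiv, h1]
  have h4 : (e σ.symm) ∘ (e σ) = id := (e σ).symm_comp_self
  rw [Matrix.submatrix_submatrix, h4, Matrix.submatrix_id_id, h2] at h3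
  exact h3.symm

lemma trace_submatrix_equiv {κ ι : Type*} [Fintype κ] [Fintype ι] (e : ι ≃ κ)
    (M : Matrix κ κ ℂ) : (M.submatrix e e).trace = M.trace := by
  simp only [Matrix.trace, Matrix.diag_apply, Matrix.submatrix_apply]
  exact Equiv.sum_comp e fun i => M i i

lemma mmis_submatrix (σ : Equiv.Perm Λ) :
    (mmis U Λ).submatrix (fun s => s ∘ σ) (fun s => s ∘ σ) = mmis U Λ := by
  exact congrArg (((Module.finrank ℂ (invariantSector U Λ) : ℂ)⁻¹) • ·)
    (invariantProj_submatrix (U := U) σ)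

lemma trace_mmis_mul_onSite_perm (σ : Equiv.Perm Λ) (x : Λ) (A : Matrix (Fin d) (Fin d) ℂ) :
    (mmis U Λ * onSite (σ x) A).trace = (mmis U Λ * onSite x A).trace := by
  let e : (Λ → Fin d) ≃ (Λ → Fin d) := σ.symm.arrowCongr (Equiv.refl _)
  rw [← onSite_submatrix, ← mmis_submatrix (U := U) σ]
  conv_rhs => rw [mmis_submatrix (U := U) σ, ← trace_submatrix_equiv e, ← Matrix.submatrix_mul_equiv _ _ e e]
  rfl

lemma trace_mmis_mul_onSite_mul_onSite_perm (σ : Equiv.Perm Λ) (x y : Λ)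
    (A B : Matrix (Fin d) (Fin d) ℂ) :
    (mmis U Λ * (onSite (σ x) A * onSite (σ y) B)).trace =
      (mmis U Λ * (onSite x A * onSite y B)).trace := by
  let e : (Λ → Fin d) ≃ (Λ → Fin d) := σ.symm.arrowCongr (Equiv.refl _)
  rw [← onSite_submatrix, ← onSite_submatrix, ← mmis_submatrix (U := U) σ]
  conv_rhs => rw [mmis_submatrix (U := U) σ, ← trace_submatrix_equiv e, ← Matrix.submatrix_mul_equiv _ _ e e,
    ← Matrix.submatrix_mul_equiv _ _ e e]
  rfl

/-! ### Infinitesimal generators and their sum rules -/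

/-- `A` is the velocity at the identity of a curve in the image of `U`. -/
def IsGenerator (U : G →* Matrix.unitaryGroup (Fin d) ℂ) (A : Matrix (Fin d) (Fin d) ℂ) : Prop :=
  ∃ γ : ℝ → G, γ 0 = 1 ∧
    ∀ i j, HasDerivAt (fun t => (U (γ t) : Matrix (Fin d) (Fin d) ℂ) i j) (A i j) 0

variable {A : Matrix (Fin d) (Fin d) ℂ}

/-- Derivative of `U(γ t)† U(γ t) = 1` at `t = 0`. -/
lemma IsGenerator.conjTranspose_eq (hA : IsGenerator U A) : A.conjTranspose = -A := by
  obtain ⟨γ, h0, hγ⟩ := hA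
  ext i j
  have h1 : HasDerivAt (fun t => ∑ k, star ((U (γ t) : Matrix (Fin d) (Fin d) ℂ) k i) *
      (U (γ t) : Matrix (Fin d) (Fin d) ℂ) k j)
      (∑ k, (star (A k i) * (U (γ 0) : Matrix (Fin d) (Fin d) ℂ) k j +
        star ((U (γ 0) : Matrix (Fin d) (Fin d) ℂ) k i) * A k j)) 0 :=
    HasDerivAt.fun_sum fun k _ => (hγ k i).star.mul (hγ k j)
  have h2 : (fun t => ∑ k, star ((U (γ t) : Matrix (Fin d) (Fin d) ℂ) k i) *
      (U (γ t) : Matrix (Fin d) (Fin d) ℂ) k j) =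
      fun _ => (1 : Matrix (Fin d) (Fin d) ℂ) i j := by
    funext t
    have := Matrix.mem_unitaryGroup_iff'.1 (U (γ t)).2
    rw [← this, Matrix.mul_apply]
    rfl
  rw [h2] at h1
  have h3 := h1.unique (hasDerivAt_const _ _)
  rw [h0, map_one] at h3
  simp only [OneMemClass.coe_one, Matrix.one_apply, Finset.sum_add_distrib, mul_ite, mul_one,
    mul_zero, Finset.sum_ite_eq', Finset.mem_univ, if_true, apply_ite (star : ℂ → ℂ), star_one,
    star_zero, ite_mul, one_mul, zero_mul] at h3
  rw [Matrix.conjTranspose_apply, Matrix.neg_apply]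
  exact eq_neg_of_add_eq_zero_left h3

lemma IsGenerator.sum_onSite_mulVec (hA : IsGenerator U A) {ψ : EuclideanSpace ℂ (Λ → Fin d)}
    (hψ : ψ ∈ invariantSector U Λ) : (∑ x, onSite x A).mulVec ψ.ofLp = 0 := by
  obtain ⟨γ, h0, hγ⟩ := hA
  have hE : ∀ s t : Λ → Fin d, HasDerivAt
      (fun r => onEverySite Λ (U (γ r) : Matrix (Fin d) (Fin d) ℂ) s t)
      ((∑ x, onSite x A) s t) 0 := by
    intro s t
    -- By the Leibniz rule, with `U(γ 0) = 1` in the undifferentiated factors, each term is one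
    -- `onSite x A`.
    have h1 := HasDerivAt.fun_finsetProd (u := Finset.univ) fun x _ => hγ (s x) (t x)
    refine h1.congr_deriv ?_
    symm
    rw [Matrix.sum_apply]
    refine Finset.sum_congr rfl fun x _ => ?_
    rw [h0, map_one]
    simp only [OneMemClass.coe_one, Matrix.one_apply, Finset.prod_ite_zero, onSite,
      Matrix.of_apply, Finset.mem_erase, Finset.mem_univ, and_true, Finset.prod_const_one,
      smul_eq_mul, ite_mul, one_mul, zero_mul]
  funext s
  have h1 : HasDerivAt
      (fun r => (onEverySite Λ (U (γ r) : Matrix (Fin d) (Fin d) ℂ)).mulVec ψ.ofLp s)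
      ((∑ x, onSite x A).mulVec ψ.ofLp s) 0 :=
    HasDerivAt.fun_sum fun t _ => (hE s t).mul_const _
  have h2 : (fun r => (onEverySite Λ (U (γ r) : Matrix (Fin d) (Fin d) ℂ)).mulVec ψ.ofLp s) =
      fun _ => ψ.ofLp s := funext fun r => congrFun (hψ (γ r)) s
  rw [h2] at h1
  exact h1.unique (hasDerivAt_const _ _)

lemma IsGenerator.sum_onSite_mul_mmis (hA : IsGenerator U A) :
    (∑ x, onSite x A) * mmis U Λ = 0 := by
  rw [mmis_eq, Matrix.mul_smul, mul_invariantProj_eq (B := 0), Matrix.zero_mul, smul_zero]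
  intro ψ hψ
  rw [hA.sum_onSite_mulVec hψ, Matrix.zero_mulVec]

/-- The expectation values are equal at all sites and sum to zero. A zero invariant sector is no
exception, since `mmis` is then zero. -/
lemma IsGenerator.trace_mmis_mul_onSite (hA : IsGenerator U A) (x : Λ) :
    (mmis U Λ * onSite x A).trace = 0 := by
  have h1 : (mmis U Λ * ∑ y, onSite y A).trace = 0 := by
    rw [Matrix.trace_mul_comm, hA.sum_onSite_mul_mmis, Matrix.trace_zero]
  have h2 : ∀ y, (mmis U Λ * onSite y A).trace = (mmis U Λ * onSite x A).trace := fun y => by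
    rw [← trace_mmis_mul_onSite_perm (U := U) (Equiv.swap x y) x, Equiv.swap_apply_left]
  rw [Matrix.mul_sum, Matrix.trace_sum, Finset.sum_congr rfl fun y _ => h2 y, Finset.sum_const,
    smul_eq_zero] at h1
  exact h1.resolve_left (Finset.card_ne_zero_of_mem (Finset.mem_univ x))

/-- The sum rule for the two-point function of a generator. -/
lemma IsGenerator.trace_mmis_mul_onSite_mul_onSite (hA : IsGenerator U A) {x y : Λ}
    (hxy : x ≠ y) :
    ((Fintype.card Λ : ℂ) - 1) * (mmis U Λ * (onSite x A * onSite y A)).trace =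
      -(mmis U Λ * onSite x (A * A)).trace := by
  have h1 : (mmis U Λ * (onSite x A * ∑ z, onSite z A)).trace = 0 := by
    rw [← Matrix.mul_assoc, Matrix.trace_mul_comm, ← Matrix.mul_assoc, hA.sum_onSite_mul_mmis,
      Matrix.zero_mul, Matrix.trace_zero]
  -- The transposition of `z` and `y` fixes `x`, so the `N - 1` terms with `z ≠ x` coincide.
  have h2 : ∀ z ∈ Finset.univ.erase x, (mmis U Λ * (onSite x A * onSite z A)).trace =
      (mmis U Λ * (onSite x A * onSite y A)).trace := fun z hz => by
    have hzx := Finset.ne_of_mem_erase hz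
    rw [← trace_mmis_mul_onSite_mul_onSite_perm (U := U) (Equiv.swap z y) x z, Equiv.swap_apply_left,
      Equiv.swap_apply_of_ne_of_ne hzx.symm hxy]
  rw [Matrix.mul_sum, Matrix.mul_sum, Matrix.trace_sum,
    ← Finset.add_sum_erase _ _ (Finset.mem_univ x), Finset.sum_congr rfl h2, Finset.sum_const,
    Finset.card_erase_of_mem (Finset.mem_univ x), onSite_mul, Finset.card_univ, nsmul_eq_mul,
    Nat.cast_sub (Fintype.card_pos_iff.2 ⟨x⟩), Nat.cast_one] at h1
  exact eq_neg_of_add_eq_zero_right h1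

/-! ### One-site reduced states -/

/-- Schur's lemma holds for `U`: only the scalars commute with all `U g`. -/
def HasScalarCommutant (U : G →* Matrix.unitaryGroup (Fin d) ℂ) : Prop :=
  ∀ R : Matrix (Fin d) (Fin d) ℂ,
    (∀ g, R * (U g : Matrix (Fin d) (Fin d) ℂ) = (U g : Matrix (Fin d) (Fin d) ℂ) * R) →
      ∃ c : ℂ, R = c • 1

/-- A Hermitian `M` that absorbs `U(g)^{⊗Λ}` on the left also absorbs it on the right. General `M`
is needed: the lemma serves both the MMIS and the pure states of a decomposition of it. -/
lemma trace_mul_unitary_conj (M : Op d Λ) (g : G) (x : Λ) (B : Matrix (Fin d) (Fin d) ℂ)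
    (hM : onEverySite Λ (U g : Matrix (Fin d) (Fin d) ℂ) * M = M) (hM' : M.conjTranspose = M) :
    (M * onSite x ((U g : Matrix (Fin d) (Fin d) ℂ).conjTranspose * B *
      (U g : Matrix (Fin d) (Fin d) ℂ))).trace = (M * onSite x B).trace := by
  set V := (U g : Matrix (Fin d) (Fin d) ℂ)
  have hV : V * V.conjTranspose = 1 := Matrix.mem_unitaryGroup_iff.1 (U g).2
  have hV' : V.conjTranspose * V = 1 := Matrix.mem_unitaryGroup_iff'.1 (U g).2
  have h1 : onSite x B * onEverySite Λ V = onEverySite Λ V * onSite x (V.conjTranspose * B * V) :=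
    onSite_mul_onEverySite x (by rw [← Matrix.mul_assoc, ← Matrix.mul_assoc, hV, Matrix.one_mul])
  have h2 : M * onEverySite Λ V.conjTranspose = M := by
    have := congrArg Matrix.conjTranspose hM
    rwa [Matrix.conjTranspose_mul, hM', conjTranspose_onEverySite] at this
  have h3 : M * onEverySite Λ V = M := by
    conv_lhs => rw [← h2]
    rw [Matrix.mul_assoc, ← onEverySite_mul, hV', onEverySite_one, Matrix.mul_one]
  conv_lhs => rw [← h3]
  rw [Matrix.mul_assoc, ← h1, ← Matrix.mul_assoc, Matrix.trace_mul_comm, ← Matrix.mul_assoc, hM]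

lemma HasScalarCommutant.trace_mul_onSite (hU : HasScalarCommutant U) {M : Op d Λ}
    (hM : ∀ g, onEverySite Λ (U g : Matrix (Fin d) (Fin d) ℂ) * M = M)
    (hM' : M.conjTranspose = M) (x : Λ) :
    ∃ c : ℂ, ∀ B, (M * onSite x B).trace = c * B.trace := by
  let f : Matrix (Fin d) (Fin d) ℂ →ₗ[ℂ] ℂ :=
    (Matrix.traceLinearMap _ ℂ ℂ) ∘ₗ (LinearMap.mulLeft ℂ M) ∘ₗ onSiteLinear x
  have hf : ∀ B, f B = (M * onSite x B).trace := fun B => rfl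
  -- The reduced density matrix of `M` at `x`: it represents `f` in the trace pairing, whence the
  -- swapped indices. Invariance of `f` under conjugation makes it commute with `U`.
  let R : Matrix (Fin d) (Fin d) ℂ := Matrix.of fun i j => f (Matrix.single j i 1)
  have hR : ∀ B, (R * B).trace = f B := by
    intro B
    conv_rhs => rw [Matrix.matrix_eq_sum_single B]
    simp only [Matrix.trace, Matrix.diag_apply, Matrix.mul_apply, map_sum]
    rw [Finset.sum_comm]
    refine Finset.sum_congr rfl fun i _ => Finset.sum_congr rfl fun j _ => ?_
    rw [show Matrix.single i j (B i j) = B i j • Matrix.single i j (1 : ℂ) by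
      rw [Matrix.smul_single, smul_eq_mul, mul_one], map_smul, smul_eq_mul, mul_comm]
    rfl
  obtain ⟨c, hc⟩ := hU R fun g => by
    set V := (U g : Matrix (Fin d) (Fin d) ℂ) with hV
    have hVV : V.conjTranspose * V = 1 := Matrix.mem_unitaryGroup_iff'.1 (U g).2
    have h1 : V * R * V.conjTranspose = R := by
      refine Matrix.ext_iff_trace_mul_right.2 fun B => ?_
      rw [hR, hf, ← trace_mul_unitary_conj M g x B (hM g) hM', ← hf, ← hR, Matrix.mul_assoc,
        Matrix.mul_assoc, Matrix.trace_mul_comm]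
      simp only [Matrix.mul_assoc, ← hV]
    conv_lhs => rw [← h1]
    rw [Matrix.mul_assoc, hVV, Matrix.mul_one]
  exact ⟨c, fun B => by rw [← hf, ← hR, hc, Matrix.smul_mul, Matrix.one_mul, Matrix.trace_smul,
    smul_eq_mul]⟩

end System

section Circuits

open scoped Kronecker

variable {d : ℕ} {Λ : Type} [Fintype Λ] [DecidableEq Λ]

/-! ### Supports of operators -/

/-- Splitting the sites into the sites in `S` and the sites outside of `S`. -/
def splitSites (d : ℕ) (S : Finset Λ) :
    (Λ → Fin d) ≃ (S → Fin d) × ({z // z ∉ S} → Fin d) :=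
  Equiv.piEquivPiSubtypeProd (fun z => z ∈ S) fun _ => Fin d

lemma kronecker_one_submatrix_apply (S : Finset Λ) (w : Matrix (S → Fin d) (S → Fin d) ℂ)
    (s t : Λ → Fin d) :
    (w ⊗ₖ (1 : Matrix ({z // z ∉ S} → Fin d) ({z // z ∉ S} → Fin d) ℂ)).submatrix
      (splitSites d S) (splitSites d S) s t =
    if ∀ z, z ∉ S → s z = t z then w (fun z => s z) (fun z => t z) else 0 := by
  rw [Matrix.submatrix_apply, Matrix.kronecker_apply, Matrix.one_apply, mul_ite, mul_one, mul_zero]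
  refine if_congr ?_ rfl rfl
  rw [funext_iff, Subtype.forall]
  rfl

lemma actsOn_iff {S : Finset Λ} {W : Op d Λ} :
    ActsOn S W ↔ ∃ w : Matrix (S → Fin d) (S → Fin d) ℂ,
      W = (w ⊗ₖ (1 : Matrix ({z // z ∉ S} → Fin d) ({z // z ∉ S} → Fin d) ℂ)).submatrix
        (splitSites d S) (splitSites d S) := by
  refine exists_congr fun w => ⟨fun h => ?_, fun h s t => ?_⟩
  · ext s t
    rw [h, kronecker_one_submatrix_apply]
  · rw [h, kronecker_one_submatrix_apply]

lemma ActsOn.exists_of_disjoint {S T : Finset Λ} (hST : Disjoint S T) {W : Op d Λ}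
    (hW : ActsOn T W) :
    ∃ w : Matrix ({z // z ∉ S} → Fin d) ({z // z ∉ S} → Fin d) ℂ,
      W = ((1 : Matrix (S → Fin d) (S → Fin d) ℂ) ⊗ₖ w).submatrix
        (splitSites d S) (splitSites d S) := by
  obtain ⟨w, hw⟩ := hW
  have hT : ∀ z ∈ T, z ∉ S := fun z hz hS => Finset.disjoint_left.1 hST hS hz
  refine ⟨Matrix.of fun a b => if ∀ z : {z // z ∉ S}, z.1 ∉ T → a z = b z then
    w (fun z => a ⟨z, hT z z.2⟩) (fun z => b ⟨z, hT z z.2⟩) else 0, ?_⟩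
  ext s t
  rw [hw, Matrix.submatrix_apply, Matrix.kronecker_apply, Matrix.one_apply, Matrix.of_apply,
    ite_mul, one_mul, zero_mul, ← ite_and]
  refine if_congr ⟨fun h => ⟨funext fun z => h z (Finset.disjoint_left.1 hST z.2),
    fun z hz => h z hz⟩, fun h z hz => ?_⟩ rfl rfl
  by_cases hS : z ∈ S
  · exact congrFun h.1 ⟨z, hS⟩
  · exact h.2 ⟨z, hS⟩ hz

lemma ActsOn.mul {S : Finset Λ} {A B : Op d Λ} (hA : ActsOn S A) (hB : ActsOn S B) :
    ActsOn S (A * B) := by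
  obtain ⟨a, rfl⟩ := actsOn_iff.1 hA
  obtain ⟨b, rfl⟩ := actsOn_iff.1 hB
  refine actsOn_iff.2 ⟨a * b, ?_⟩
  rw [Matrix.submatrix_mul_equiv, ← Matrix.mul_kronecker_mul, Matrix.one_mul]

lemma ActsOn.conjTranspose {S : Finset Λ} {A : Op d Λ} (hA : ActsOn S A) :
    ActsOn S A.conjTranspose := by
  obtain ⟨a, rfl⟩ := actsOn_iff.1 hA
  refine actsOn_iff.2 ⟨a.conjTranspose, ?_⟩
  rw [Matrix.conjTranspose_submatrix, Matrix.conjTranspose_kronecker, Matrix.conjTranspose_one]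

lemma ActsOn.mono {S T : Finset Λ} (hST : S ⊆ T) {A : Op d Λ} (hA : ActsOn S A) :
    ActsOn T A := by
  obtain ⟨w, hw⟩ := hA
  refine ⟨Matrix.of fun a b => if ∀ z : T, z.1 ∉ S → a z = b z then
    w (fun z => a ⟨z, hST z.2⟩) (fun z => b ⟨z, hST z.2⟩) else 0, fun s t => ?_⟩
  rw [hw, Matrix.of_apply, ← ite_and]
  refine if_congr ⟨fun h => ⟨fun z hz => h z fun hS => hz (hST hS), fun z hz => h z hz⟩,
    fun h z hz => ?_⟩ rfl rfl
  by_cases hT : z ∈ T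
  · exact h.2 ⟨z, hT⟩ hz
  · exact h.1 z hT

lemma actsOn_onSite (x : Λ) (A : Matrix (Fin d) (Fin d) ℂ) : ActsOn {x} (onSite x A) :=
  ⟨Matrix.of fun a b => A (a ⟨x, Finset.mem_singleton_self x⟩)
    (b ⟨x, Finset.mem_singleton_self x⟩), fun s t => by
      simp only [onSite, Matrix.of_apply, Finset.mem_singleton, ne_eq]⟩

lemma ActsOn.commute {S T : Finset Λ} (hST : Disjoint S T) {A B : Op d Λ} (hA : ActsOn S A)
    (hB : ActsOn T B) : A * B = B * A := by
  obtain ⟨a, rfl⟩ := actsOn_iff.1 hA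
  obtain ⟨b, rfl⟩ := hB.exists_of_disjoint hST
  simp only [Matrix.submatrix_mul_equiv, ← Matrix.mul_kronecker_mul, Matrix.one_mul,
    Matrix.mul_one]

/-! ### Product states have no correlations -/

/-- Across the cut between `S` and its complement, the state and both operators are Kronecker
products, and traces of these multiply. The factor `ρ.trace` makes normalization unnecessary. -/
lemma trace_productState_mul {S T : Finset Λ} (hST : Disjoint S T) {A B : Op d Λ}
    (hA : ActsOn S A) (hB : ActsOn T B) (φ : Λ → EuclideanSpace ℂ (Fin d)) :
    let ρ : Op d Λ := Matrix.vecMulVec (productVector φ) (star (productVector φ))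
    (ρ * (A * B)).trace * ρ.trace = (ρ * A).trace * (ρ * B).trace := by
  intro ρ
  let f : (S → Fin d) → ℂ := fun a => ∏ z, φ z.1 (a z)
  let g : ({z // z ∉ S} → Fin d) → ℂ := fun a => ∏ z, φ z.1 (a z)
  have hΦ : ∀ s, productVector φ s = f (splitSites d S s).1 * g (splitSites d S s).2 := fun s => by
    rw [productVector, ← Fintype.prod_subtype_mul_prod_subtype (fun z => z ∈ S)]
    convert rfl <;> rfl
  have hρ : ρ = (Matrix.vecMulVec f (star f) ⊗ₖ Matrix.vecMulVec g (star g)).submatrix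
      (splitSites d S) (splitSites d S) := by
    ext s t
    simp only [ρ, Matrix.vecMulVec_apply, Matrix.submatrix_apply, Matrix.kroneckerMap_apply,
      Pi.star_apply, hΦ, star_mul']
    ring
  obtain ⟨a, rfl⟩ := actsOn_iff.1 hA
  obtain ⟨b, rfl⟩ := hB.exists_of_disjoint hST
  rw [hρ]
  simp only [Matrix.submatrix_mul_equiv, ← Matrix.mul_kronecker_mul, Matrix.one_mul,
    Matrix.mul_one, trace_submatrix_equiv, Matrix.trace_kronecker]
  ring

lemma star_dotProduct_productVector {φ : Λ → EuclideanSpace ℂ (Fin d)} (hφ : ∀ x, ‖φ x‖ = 1) :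
    productVector φ ⬝ᵥ star (productVector φ) = 1 := by
  have h1 : ∀ x, ∑ k, φ x k * star (φ x k) = 1 := fun x => by
    have := EuclideanSpace.inner_eq_star_dotProduct (φ x) (φ x)
    rw [inner_self_eq_norm_sq_to_K, hφ x] at this
    simpa [dotProduct] using this.symm
  simp only [dotProduct, productVector, Pi.star_apply, star_prod, ← Finset.prod_mul_distrib]
  have h2 := Finset.prod_univ_sum (fun _ : Λ => (Finset.univ : Finset (Fin d)))
    fun x k => φ x k * star (φ x k)
  rw [Fintype.piFinset_univ] at h2
  rw [← h2]
  exact Finset.prod_eq_one fun x _ => h1 x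

/-! ### Light cones of circuits -/

/-- In the Heisenberg picture a gate disjoint from the support `T` cancels against its adjoint, and
a gate that meets `T` adds its own set to the support. `R` has to contain `T` and all the sets that
meet it. -/
lemma actsOn_conj_gates : ∀ (k : ℕ) (S : Fin k → Finset Λ) (W : Fin k → Op d Λ)
    (_ : ∀ i j, i ≠ j → Disjoint (S i) (S j))
    (_ : ∀ i, W i ∈ Matrix.unitaryGroup (Λ → Fin d) ℂ) (_ : ∀ i, ActsOn (S i) (W i))
    (A : Op d Λ) (T R : Finset Λ) (_ : ActsOn T A) (_ : T ⊆ R)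
    (_ : ∀ i, ¬Disjoint (S i) T → S i ⊆ R),
    ActsOn R ((List.ofFn W).prod.conjTranspose * A * (List.ofFn W).prod)
  | 0, S, W, _, _, _, A, T, R, hA, hTR, _ => by
    rw [List.ofFn_zero, List.prod_nil, Matrix.conjTranspose_one, Matrix.one_mul, Matrix.mul_one]
    exact hA.mono hTR
  | k + 1, S, W, hS, hW, hSW, A, T, R, hA, hTR, hR => by
    rw [List.ofFn_succ, List.prod_cons, Matrix.conjTranspose_mul]
    have hW0 : (W 0).conjTranspose * W 0 = 1 := Matrix.mem_unitaryGroup_iff'.1 (hW 0)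
    have ih := actsOn_conj_gates k (fun i => S i.succ) (fun i => W i.succ)
      (fun i j hij => hS _ _ fun h => hij (Fin.succ_injective _ h)) (fun i => hW _)
      (fun i => hSW _)
    set L := (List.ofFn fun i : Fin k => W i.succ).prod
    rw [show L.conjTranspose * (W 0).conjTranspose * A * (W 0 * L) =
      L.conjTranspose * ((W 0).conjTranspose * A * W 0) * L by simp only [Matrix.mul_assoc]]
    by_cases h0 : Disjoint (S 0) T
    · rw [Matrix.mul_assoc (W 0).conjTranspose, ← (hSW 0).commute h0 hA,
        ← Matrix.mul_assoc (W 0).conjTranspose, hW0, Matrix.one_mul]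
      exact ih A T R hA hTR fun i => hR _
    -- The remaining gates are disjoint from `S 0`, so those that meet `T ∪ S 0` already meet `T`: a
    -- layer does not spread further than one gate.
    · refine ih _ (T ∪ S 0) R ?_ (Finset.union_subset hTR (hR 0 h0)) fun i hi => hR _ fun h => hi ?_
      · have hS0 := (hSW 0).mono (Finset.subset_union_right (s₁ := T))
        exact (hS0.conjTranspose.mul (hA.mono Finset.subset_union_left)).mul hS0
      · exact Finset.disjoint_union_right.2 ⟨h, hS _ _ (Fin.succ_ne_zero i)⟩

variable [MetricSpace Λ]

/-- The sites at distance at most `a` from `x`. -/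
def siteBall (x : Λ) (a : ℝ) : Finset Λ := by
  classical exact Finset.univ.filter fun y => dist y x ≤ a

omit [DecidableEq Λ] in
lemma mem_siteBall {x y : Λ} {a : ℝ} : y ∈ siteBall x a ↔ dist y x ≤ a := by
  simp [siteBall]

lemma IsLayer.actsOn_conj {r : ℝ} {L : Op d Λ} (hL : IsLayer r L) {x : Λ} {a : ℝ} {A : Op d Λ}
    (hA : ActsOn (siteBall x a) A) :
    ActsOn (siteBall x (a + |r|)) (L.conjTranspose * A * L) := by
  obtain ⟨k, S, W, hS, hr, hW, hSW, rfl⟩ := hL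
  refine actsOn_conj_gates k S W hS hW hSW A _ _ hA (fun y hy => ?_) fun i hi y hy => ?_
  · exact mem_siteBall.2 ((mem_siteBall.1 hy).trans (le_add_of_nonneg_right (abs_nonneg r)))
  · obtain ⟨z, hz, hzx⟩ := Finset.not_disjoint_iff.1 hi
    have h1 := mem_siteBall.1 hzx
    have h2 := (hr i y hy z hz).trans (le_abs_self r)
    exact mem_siteBall.2 ((dist_triangle y z x).trans (by linarith))

/-- Each layer widens the light cone by at most `|r|`; the absolute value keeps the radii monotone
for negative `r`. -/
lemma IsCircuit.actsOn_conj {r : ℝ} : ∀ {D : ℕ} {W : Op d Λ} (_ : IsCircuit r D W) {x : Λ} {a : ℝ}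
    {A : Op d Λ} (_ : ActsOn (siteBall x a) A),
    ActsOn (siteBall x (a + D * |r|)) (W.conjTranspose * A * W)
  | 0, W, hW, x, a, A, hA => by
    rw [show W = 1 from hW, Matrix.conjTranspose_one, Matrix.one_mul, Matrix.mul_one,
      Nat.cast_zero, zero_mul, add_zero]
    exact hA
  | D + 1, W, ⟨L, W', hL, hW', h⟩, x, a, A, hA => by
    have := hW'.actsOn_conj (hL.actsOn_conj hA)
    rw [h, Matrix.conjTranspose_mul]
    simp only [Matrix.mul_assoc] at this ⊢
    rwa [show a + ((D + 1 : ℕ) : ℝ) * |r| = a + |r| + D * |r| by push_cast; ring]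

lemma IsLayer.mem_unitaryGroup {r : ℝ} {L : Op d Λ} (hL : IsLayer r L) :
    L ∈ Matrix.unitaryGroup (Λ → Fin d) ℂ := by
  obtain ⟨k, S, W, -, -, hW, -, rfl⟩ := hL
  exact list_prod_mem fun w hw => by
    obtain ⟨i, rfl⟩ := List.mem_ofFn.1 hw
    exact hW i

lemma IsCircuit.mem_unitaryGroup {r : ℝ} : ∀ {D : ℕ} {W : Op d Λ} (_ : IsCircuit r D W),
    W ∈ Matrix.unitaryGroup (Λ → Fin d) ℂ
  | 0, W, hW => by rw [show W = 1 from hW]; exact one_mem _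
  | D + 1, W, ⟨L, W', hL, hW', h⟩ => by
    rw [h]; exact mul_mem hL.mem_unitaryGroup hW'.mem_unitaryGroup

lemma IsCircuit.trace_vecMulVec_mul_onSite_mul_onSite {r : ℝ} {D : ℕ} {W : Op d Λ}
    (hW : IsCircuit r D W) {φ : Λ → EuclideanSpace ℂ (Fin d)} (hφ : ∀ x, ‖φ x‖ = 1) {x y : Λ}
    (hxy : 2 * (D * |r|) < dist x y) (A B : Matrix (Fin d) (Fin d) ℂ) :
    let ρ : Op d Λ := Matrix.vecMulVec (W.mulVec (productVector φ))
      (star (W.mulVec (productVector φ)))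
    (ρ * (onSite x A * onSite y B)).trace = (ρ * onSite x A).trace * (ρ * onSite y B).trace := by
  intro ρ
  set ρ₀ : Op d Λ := Matrix.vecMulVec (productVector φ) (star (productVector φ)) with hρ₀
  have hρ : ρ = W * ρ₀ * W.conjTranspose := by
    rw [hρ₀, Matrix.mul_vecMulVec, Matrix.vecMulVec_mul, ← Matrix.star_mulVec]
  have hWW : W * W.conjTranspose = 1 := Matrix.mem_unitaryGroup_iff.1 hW.mem_unitaryGroup
  have htr : ∀ M : Op d Λ, (ρ * M).trace = (ρ₀ * (W.conjTranspose * M * W)).trace := fun M => by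
    rw [hρ, Matrix.mul_assoc, Matrix.mul_assoc, Matrix.trace_mul_comm]
    simp only [Matrix.mul_assoc]
  have hA : ∀ (z : Λ) (C : Matrix (Fin d) (Fin d) ℂ), ActsOn (siteBall z (0 + D * |r|))
      (W.conjTranspose * onSite z C * W) := fun z C =>
    hW.actsOn_conj ((actsOn_onSite z C).mono fun u hu => mem_siteBall.2 (by
      rw [Finset.mem_singleton.1 hu, dist_self]))
  have hdis : Disjoint (siteBall x (0 + D * |r|)) (siteBall y (0 + D * |r|)) :=
    Finset.disjoint_left.2 fun z hx hy => by
      have h1 := mem_siteBall.1 hx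
      have h2 := mem_siteBall.1 hy
      have h3 := dist_triangle_left x y z
      linarith
  have key := trace_productState_mul hdis (hA x A) (hA y B) φ
  simp only [← hρ₀] at key
  rw [show ρ₀.trace = 1 by rw [hρ₀, Matrix.trace_vecMulVec, star_dotProduct_productVector hφ],
    mul_one] at key
  rw [htr, htr, htr, ← key]
  congr 2
  simp only [Matrix.mul_assoc]
  rw [← Matrix.mul_assoc W, hWW, Matrix.one_mul]

end Circuits

section LongRange

open scoped ComplexOrder

variable {d : ℕ} {Λ : Type} [Fintype Λ] [DecidableEq Λ] {G : Type*} [Monoid G]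
  {U : G →* Matrix.unitaryGroup (Fin d) ℂ}

/-! ### Long-range entanglement -/

lemma invariantProj_mul_mmis : invariantProj U Λ * mmis U Λ = mmis U Λ := by
  rw [mmis_eq, Matrix.mul_smul, invariantProj_mul_self]

/-- The pure states in a decomposition of the maximally mixed invariant state are invariant. -/
lemma invariantProj_mulVec_of_sum_eq_mmis {ι : Type*} [Fintype ι] {w : ι → ℝ}
    (hw : ∀ i, 0 ≤ w i) {ψ : ι → (Λ → Fin d) → ℂ}
    (h : ∑ i, w i • Matrix.vecMulVec (ψ i) (star (ψ i)) = mmis U Λ) {i : ι} (hi : w i ≠ 0) :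
    (invariantProj U Λ).mulVec (ψ i) = ψ i := by
  set P := invariantProj U Λ
  set Q : Op d Λ := 1 - P with hQ
  have hQH : Q.conjTranspose = Q := by
    rw [hQ, Matrix.conjTranspose_sub, Matrix.conjTranspose_one, invariantProj_conjTranspose]
  have hQQ : Q * Q = Q := by
    simp only [hQ, mul_sub, sub_mul, one_mul, mul_one, P, invariantProj_mul_self, sub_self,
      sub_zero]
  have h1 : ∀ j, (Q * Matrix.vecMulVec (ψ j) (star (ψ j))).trace =
      star (Q.mulVec (ψ j)) ⬝ᵥ Q.mulVec (ψ j) := fun j => by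
    conv_lhs => rw [← hQQ, Matrix.mul_assoc, Matrix.trace_mul_comm, Matrix.mul_vecMulVec,
      Matrix.vecMulVec_mul, Matrix.trace_vecMulVec, dotProduct_comm]
    rw [Matrix.star_mulVec, hQH]
  -- The weight of `ρ` outside the sector, `Tr Qρ = ∑ w_j ‖Q ψ_j‖²`, vanishes, so each nonnegative
  -- term does.
  have h2 : ∑ j, (w j : ℂ) * (star (Q.mulVec (ψ j)) ⬝ᵥ Q.mulVec (ψ j)) = 0 := by
    have := congrArg (fun M => (Q * M).trace) h
    simp only [Matrix.mul_sum, Matrix.trace_sum, Matrix.mul_smul, Matrix.trace_smul, h1] at this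
    rw [hQ, Matrix.sub_mul, invariantProj_mul_mmis, Matrix.one_mul, sub_self,
      Matrix.trace_zero] at this
    simpa only [Complex.real_smul] using this
  have h3 := (Finset.sum_eq_zero_iff_of_nonneg fun j _ => mul_nonneg
    (Complex.zero_le_real.2 (hw j)) (dotProduct_star_self_nonneg _)).1 h2 i (Finset.mem_univ i)
  have h4 := dotProduct_star_self_eq_zero.1
    ((mul_eq_zero.1 h3).resolve_left (Complex.ofReal_ne_zero.2 hi))
  rw [hQ, Matrix.sub_mulVec, Matrix.one_mulVec, sub_eq_zero] at h4
  exact h4.symm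

lemma mmis_conjTranspose : (mmis U Λ).conjTranspose = mmis U Λ := by
  rw [mmis_eq, Matrix.conjTranspose_smul, invariantProj_conjTranspose]
  simp

lemma onEverySite_mul_mmis (g : G) :
    onEverySite Λ (U g : Matrix (Fin d) (Fin d) ℂ) * mmis U Λ = mmis U Λ := by
  rw [mmis_eq, Matrix.mul_smul, onEverySite_mul_invariantProj]

lemma HasScalarCommutant.trace_mmis_mul_onSite (hU : HasScalarCommutant U)
    (hΛ : invariantSector U Λ ≠ ⊥) (x : Λ) :
    ∃ c : ℂ, c ≠ 0 ∧ ∀ B, (mmis U Λ * onSite x B).trace = c * B.trace := by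
  obtain ⟨c, hc⟩ := hU.trace_mul_onSite onEverySite_mul_mmis mmis_conjTranspose x
  refine ⟨c, fun h0 => ?_, hc⟩
  have := hc 1
  rw [onSite_one, Matrix.mul_one, trace_mmis hΛ, h0, zero_mul] at this
  exact one_ne_zero this

theorem isLongRangeEntangled_of_generator (hU : HasScalarCommutant U)
    {A : Matrix (Fin d) (Fin d) ℂ} (hA : IsGenerator U A) (hA0 : A ≠ 0) :
    IsLongRangeEntangled U := by
  intro D r
  -- Twice the light-cone radius.
  refine ⟨2 * (D * |r|), ?_⟩
  rintro Λ _ _ _ hΛ ⟨x, y, hxy⟩ hmem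
  have hne : x ≠ y := fun h => by
    rw [h, dist_self] at hxy
    exact absurd hxy (not_lt.2 (by positivity))
  obtain ⟨c, hc0, hc⟩ := hU.trace_mmis_mul_onSite hΛ x
  -- The one-site reduced state is a nonzero multiple of the identity and `A` has mean zero in it.
  have htrA : A.trace = 0 := by
    have := hA.trace_mmis_mul_onSite (Λ := Λ) x
    rw [hc] at this
    exact (mul_eq_zero.1 this).resolve_left hc0
  obtain ⟨ι, _, w, z, hw, -, hz, hsum⟩ := mem_convexHull_iff_exists_fintype.1 hmem
  choose W φ hW hφ hzψ using hz
  have hterm : ∀ i, w i ≠ 0 → (z i * (onSite x A * onSite y A)).trace = 0 := by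
    intro i hi
    have hP := invariantProj_mulVec_of_sum_eq_mmis hw
      (ψ := fun i => (W i).mulVec (productVector (φ i)))
      (by rw [← hsum]; exact Finset.sum_congr rfl fun i _ => by rw [hzψ i]) hi
    have hE : ∀ g, onEverySite Λ (U g : Matrix (Fin d) (Fin d) ℂ) * z i = z i := fun g => by
      rw [hzψ i, Matrix.mul_vecMulVec]
      congr 1
      rw [← hP, Matrix.mulVec_mulVec, onEverySite_mul_invariantProj]
    obtain ⟨c', hc'⟩ := hU.trace_mul_onSite hE
      (by rw [hzψ i, Matrix.conjTranspose_vecMulVec, star_star]) x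
    have hx := hc' A
    have := (hW i).trace_vecMulVec_mul_onSite_mul_onSite (hφ i) hxy A A
    simp only [← hzψ i] at this
    rw [this, hx, htrA, mul_zero, zero_mul]
  have hcorr : (mmis U Λ * (onSite x A * onSite y A)).trace = 0 := by
    rw [← hsum, Matrix.sum_mul, Matrix.trace_sum]
    refine Finset.sum_eq_zero fun i _ => ?_
    rw [Matrix.smul_mul, Matrix.trace_smul]
    by_cases hi : w i = 0
    · rw [hi, zero_smul]
    · rw [hterm i hi, smul_zero]
  have hrule := hA.trace_mmis_mul_onSite_mul_onSite (Λ := Λ) hne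
  rw [hcorr, mul_zero, hc, zero_eq_neg] at hrule
  have htr := (mul_eq_zero.1 hrule).resolve_left hc0
  refine hA0 (Matrix.trace_conjTranspose_mul_self_eq_zero_iff.1 ?_)
  rw [hA.conjTranspose_eq, Matrix.neg_mul, Matrix.trace_neg, htr, neg_zero]

end LongRange

section LieGroups

open VectorField

variable {m d : ℕ} {G : Type*} [TopologicalSpace G] [ChartedSpace (EuclideanSpace ℝ (Fin m)) G]
  [Group G]

/-! ### Curves through the identity -/

variable (m) in
/-- The straight line in the chart at the identity with velocity `X`. -/
def chartCurve (X : EuclideanSpace ℝ (Fin m)) (t : ℝ) : G :=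
  (extChartAt (𝓡 m) (1 : G)).symm (extChartAt (𝓡 m) (1 : G) 1 + t • X)

lemma chartCurve_zero (X : EuclideanSpace ℝ (Fin m)) : chartCurve m X 0 = (1 : G) := by
  rw [chartCurve, zero_smul, add_zero, extChartAt_to_inv]

lemma hasDerivAt_comp_chartCurve {f : G → ℂ} (hf : MDifferentiableAt (𝓡 m) 𝓘(ℝ, ℂ) f 1)
    (X : EuclideanSpace ℝ (Fin m)) :
    HasDerivAt (fun t => f (chartCurve m X t)) (mfderiv (𝓡 m) 𝓘(ℝ, ℂ) f 1 X : ℂ) 0 := by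
  have h0 := hf.hasMFDerivAt.2
  rw [ModelWithCorners.Boundaryless.range_eq_univ] at h0
  have h1 : HasFDerivAt (writtenInExtChartAt (𝓡 m) 𝓘(ℝ, ℂ) (1 : G) f)
      (show EuclideanSpace ℝ (Fin m) →L[ℝ] ℂ from mfderiv (𝓡 m) 𝓘(ℝ, ℂ) f 1)
      (extChartAt (𝓡 m) (1 : G) 1) := hasFDerivWithinAt_univ.1 h0
  have h2 : HasDerivAt (fun t : ℝ => extChartAt (𝓡 m) (1 : G) 1 + t • X) X 0 := by
    simpa using ((hasDerivAt_id (0 : ℝ)).smul_const X).const_add (extChartAt (𝓡 m) (1 : G) 1)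
  have h3 := HasFDerivAt.comp_hasDerivAt_of_eq (0 : ℝ) h1 h2 (by simp)
  exact h3

omit [Group G] in
-- Tangent spaces at different points are different types with the same underlying model space;
-- stating the equality in the model space allows the base point to be changed.
lemma mfderiv_apply_congr_point {F H N : Type*} [NormedAddCommGroup F] [NormedSpace ℝ F]
    [TopologicalSpace H] {I : ModelWithCorners ℝ F H} [TopologicalSpace N] [ChartedSpace H N]
    {f : G → N} {x y : G} (h : x = y) (X : EuclideanSpace ℝ (Fin m)) :
    (mfderiv (𝓡 m) I f x X : F) = mfderiv (𝓡 m) I f y X := by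
  subst h
  rfl

omit [Group G] in
lemma mfderiv_comp_apply_congr_point {F H N : Type*} [NormedAddCommGroup F] [NormedSpace ℝ F]
    [TopologicalSpace H] {I : ModelWithCorners ℝ F H} [TopologicalSpace N] [ChartedSpace H N]
    {f : G → N} {c : G → G} {x y : G} (hf : MDifferentiable (𝓡 m) I f)
    (hc : MDifferentiable (𝓡 m) (𝓡 m) c) (h : c x = y) (X : EuclideanSpace ℝ (Fin m)) :
    (mfderiv (𝓡 m) I (f ∘ c) x X : F) = mfderiv (𝓡 m) I f y (mfderiv (𝓡 m) (𝓡 m) c x X) := by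
  rw [mfderiv_comp (I' := 𝓡 m) x (hf _) (hc x)]
  exact mfderiv_apply_congr_point h _

variable {U : G →* Matrix.unitaryGroup (Fin d) ℂ}

lemma IsSmoothRep.mdifferentiable (hU : IsSmoothRep (m := m) U) (i j : Fin d) :
    MDifferentiable (𝓡 m) 𝓘(ℝ, ℂ) (fun g : G => (U g : Matrix (Fin d) (Fin d) ℂ) i j) :=
  (hU i j).mdifferentiable (by simp)

/-- A generator needs only some curve with the right velocity, so a chart line replaces the
exponential map. -/
lemma IsSmoothRep.isGenerator (hU : IsSmoothRep (m := m) U) (X : GroupLieAlgebra (𝓡 m) G) :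
    IsGenerator U (lieRep U X) :=
  ⟨chartCurve m X, chartCurve_zero X, fun i j =>
    hasDerivAt_comp_chartCurve (hU.mdifferentiable i j 1) X⟩

variable (m U) in
/-- The derivative of `U` as a linear map. -/
def lieRepLinear : GroupLieAlgebra (𝓡 m) G →ₗ[ℝ] Matrix (Fin d) (Fin d) ℂ where
  toFun := lieRep U
  map_add' X Y := by
    ext i j
    exact map_add (mfderiv (𝓡 m) 𝓘(ℝ, ℂ)
      (fun g : G => (U g : Matrix (Fin d) (Fin d) ℂ) i j) 1) X Y
  map_smul' c X := by
    ext i j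
    exact map_smul (mfderiv (𝓡 m) 𝓘(ℝ, ℂ)
      (fun g : G => (U g : Matrix (Fin d) (Fin d) ℂ) i j) 1) c X

lemma lieRepLinear_apply (X : GroupLieAlgebra (𝓡 m) G) : lieRepLinear m U X = lieRep U X := rfl

/-! ### Representations with vanishing derivative -/

omit [Group G] in
lemma isLocallyConstant_of_mfderiv_eq_zero [IsManifold (𝓡 m) 1 G] {f : G → ℂ}
    (hf : MDifferentiable (𝓡 m) 𝓘(ℝ, ℂ) f) (h0 : ∀ g, mfderiv (𝓡 m) 𝓘(ℝ, ℂ) f g = 0) :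
    IsLocallyConstant f := by
  refine (IsLocallyConstant.iff_eventually_eq f).2 fun x => ?_
  set φ := extChartAt (𝓡 m) x with hφ
  have hopen : IsOpen φ.target := isOpen_extChartAt_target x
  obtain ⟨ε, hε, hball⟩ := Metric.isOpen_iff.1 hopen (φ x) (mem_extChartAt_target x)
  have hsymm : ∀ y ∈ φ.target, MDifferentiableAt 𝓘(ℝ, EuclideanSpace ℝ (Fin m)) (𝓡 m) φ.symm y :=
    fun y hy => ((contMDiffOn_extChartAt_symm (n := 1) x).contMDiffAt
      (hopen.mem_nhds hy)).mdifferentiableAt one_ne_zero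
  have hF : ∀ y ∈ Metric.ball (φ x) ε, HasFDerivAt (f ∘ φ.symm) (0 : _ →L[ℝ] ℂ) y := by
    intro y hy
    have h1 := (hf (φ.symm y)).hasMFDerivAt
    rw [h0] at h1
    have h2 := h1.comp y (hsymm y (hball hy)).hasMFDerivAt
    rw [ContinuousLinearMap.zero_comp] at h2
    exact h2.hasFDerivAt
  have hconst : ∀ y ∈ Metric.ball (φ x) ε, (f ∘ φ.symm) y = (f ∘ φ.symm) (φ x) := fun y hy =>
    IsOpen.is_const_of_fderiv_eq_zero (𝕜 := ℝ) Metric.isOpen_ball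
      (convex_ball _ _).isPreconnected
      (fun z hz => (hF z hz).differentiableAt.differentiableWithinAt)
      (fun z hz => (hF z hz).fderiv) hy (Metric.mem_ball_self hε)
  have hcont : ∀ᶠ y in nhds x, φ y ∈ Metric.ball (φ x) ε :=
    (continuousAt_extChartAt x).eventually (Metric.ball_mem_nhds _ hε)
  filter_upwards [hcont, extChartAt_source_mem_nhds (I := 𝓡 m) x] with y hy hys
  have := hconst _ hy
  rwa [Function.comp_apply, Function.comp_apply, φ.left_inv hys, hφ, extChartAt_to_inv] at this

variable [LieGroup (𝓡 m) ∞ G]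

/-- By left translation, a derivative that vanishes at the identity vanishes everywhere; `U` is then
locally constant, hence trivial on a connected group. -/
lemma IsSmoothRep.exists_lieRep_ne_zero [ConnectedSpace G] (hU : IsSmoothRep (m := m) U)
    (h : ∃ g, U g ≠ 1) : ∃ X : GroupLieAlgebra (𝓡 m) G, lieRep U X ≠ 0 := by
  by_contra! h0
  obtain ⟨g₀, hg₀⟩ := h
  have : IsManifold (𝓡 m) 1 G := IsManifold.of_le (n := ∞) (by simp)
  have hd : ∀ i j g, mfderiv (𝓡 m) 𝓘(ℝ, ℂ)
      (fun g : G => (U g : Matrix (Fin d) (Fin d) ℂ) i j) g = 0 := by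
    intro i j g
    -- `F h` is the entry of `U (g * h)`, a fixed linear combination of entries of `U h`.
    let F : G → ℂ := fun h => ∑ k, (U g : Matrix (Fin d) (Fin d) ℂ) i k *
      (U h : Matrix (Fin d) (Fin d) ℂ) k j
    have hFU : ∀ h, F h = (U (g * h) : Matrix (Fin d) (Fin d) ℂ) i j := fun h => by
      rw [map_mul, Submonoid.coe_mul, Matrix.mul_apply]
    have hFd : MDifferentiable (𝓡 m) 𝓘(ℝ, ℂ) F := by
      rw [show F = (fun g : G => (U g : Matrix (Fin d) (Fin d) ℂ) i j) ∘ (g * ·) from funext hFU]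
      exact (hU.mdifferentiable i j).comp
        ((contMDiff_mul_left (I := 𝓡 m) (n := ∞)).mdifferentiable (by simp))
    have hF0 : mfderiv (𝓡 m) 𝓘(ℝ, ℂ) F 1 = 0 := by
      ext X
      refine (hasDerivAt_comp_chartCurve (hFd 1) X).unique ?_
      have h1 : HasDerivAt (fun t => F (chartCurve m X t))
          (∑ k, (U g : Matrix (Fin d) (Fin d) ℂ) i k * lieRep U X k j) 0 :=
        HasDerivAt.fun_sum fun k _ =>
          (hasDerivAt_comp_chartCurve (hU.mdifferentiable k j 1) X).const_mul _
      refine h1.congr_deriv ?_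
      rw [h0 X]
      exact Finset.sum_eq_zero fun k _ => mul_zero _
    have hcomp : (fun g : G => (U g : Matrix (Fin d) (Fin d) ℂ) i j) = F ∘ (g⁻¹ * ·) := by
      funext h
      rw [Function.comp_apply, hFU, mul_inv_cancel_left]
    rw [hcomp]
    ext X
    refine (mfderiv_comp_apply_congr_point hFd
      ((contMDiff_mul_left (I := 𝓡 m) (n := ∞)).mdifferentiable (by simp))
      (inv_mul_cancel g) X).trans ?_
    rw [hF0]
    rfl
  refine hg₀ (Subtype.ext ?_)
  ext i j
  rw [(isLocallyConstant_of_mfderiv_eq_zero (hU.mdifferentiable i j)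
    (hd i j)).apply_eq_of_preconnectedSpace g₀ 1, map_one]

/-! ### The adjoint action -/

lemma contMDiff_conj (g : G) : ContMDiff (𝓡 m) (𝓡 m) ∞ (fun h : G => g * h * g⁻¹) :=
  (contMDiff_mul_right (a := g⁻¹)).comp (contMDiff_mul_left (a := g))

lemma mdifferentiable_conj (g : G) : MDifferentiable (𝓡 m) (𝓡 m) (fun h : G => g * h * g⁻¹) :=
  (contMDiff_conj g).mdifferentiable (by simp)

variable (m) in
/-- The adjoint action of a Lie group on its Lie algebra. -/
def adjointMap (g : G) : GroupLieAlgebra (𝓡 m) G →ₗ[ℝ] GroupLieAlgebra (𝓡 m) G :=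
  (mfderiv (𝓡 m) (𝓡 m) (fun h : G => g * h * g⁻¹) 1).toLinearMap

lemma conj_inv_comp_conj {G : Type*} [Group G] (g : G) :
    (fun h : G => g⁻¹ * h * g⁻¹⁻¹) ∘ (fun h : G => g * h * g⁻¹) = id := by
  funext x
  simp [mul_assoc]

lemma conj_comp_conj_inv {G : Type*} [Group G] (g : G) :
    (fun h : G => g * h * g⁻¹) ∘ (fun h : G => g⁻¹ * h * g⁻¹⁻¹) = id := by
  funext x
  simp [mul_assoc]

lemma adjointMap_inv_apply (g : G) (X : GroupLieAlgebra (𝓡 m) G) :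
    adjointMap m g⁻¹ (adjointMap m g X) = X := by
  refine (mfderiv_comp_apply_congr_point (mdifferentiable_conj g⁻¹) (mdifferentiable_conj g)
    (x := (1 : G)) (y := 1) (by simp) X).symm.trans ?_
  rw [conj_inv_comp_conj, mfderiv_id]
  rfl

lemma inverse_mfderiv_conj_apply (g h : G) (X : TangentSpace (𝓡 m) h) :
    (mfderiv (𝓡 m) (𝓡 m) (fun h : G => g * h * g⁻¹) h).inverse
      (mfderiv (𝓡 m) (𝓡 m) (fun h : G => g * h * g⁻¹) h X) = X := by
  have h1 : g⁻¹ * (g * h * g⁻¹) * g⁻¹⁻¹ = h := congrFun (conj_inv_comp_conj g) h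
  have A : mfderiv (𝓡 m) (𝓡 m) ((fun h : G => g⁻¹ * h * g⁻¹⁻¹) ∘ (fun h : G => g * h * g⁻¹)) h =
      ContinuousLinearMap.id _ _ := by
    rw [conj_inv_comp_conj]
    exact mfderiv_id
  rw [mfderiv_comp (I' := 𝓡 m) h (mdifferentiable_conj g⁻¹ _) (mdifferentiable_conj g h)] at A
  have A' : mfderiv (𝓡 m) (𝓡 m) ((fun h : G => g * h * g⁻¹) ∘ (fun h : G => g⁻¹ * h * g⁻¹⁻¹))
      (g * h * g⁻¹) = ContinuousLinearMap.id _ _ := by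
    rw [conj_comp_conj_inv]
    exact mfderiv_id
  rw [mfderiv_comp (I' := 𝓡 m) _ (mdifferentiable_conj g _) (mdifferentiable_conj g⁻¹ _), h1] at A'
  rw [ContinuousLinearMap.inverse_eq A' A]
  exact DFunLike.congr_fun A X

/-- Chain rule for `c_g ∘ L_h = L_{g h g⁻¹} ∘ c_g`, where `c_g` is conjugation and `L` left
translation. -/
lemma mulInvariantVectorField_adjointMap (g h : G) (X : GroupLieAlgebra (𝓡 m) G) :
    mulInvariantVectorField (adjointMap m g X) (g * h * g⁻¹) =
      mfderiv (𝓡 m) (𝓡 m) (fun h : G => g * h * g⁻¹) h (mulInvariantVectorField X h) := by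
  have hl : ∀ k : G, MDifferentiable (𝓡 m) (𝓡 m) (k * · : G → G) := fun k =>
    (contMDiff_mul_left (I := 𝓡 m) (n := ∞)).mdifferentiable (by simp)
  have h1 := mfderiv_comp_apply_congr_point (hl (g * h * g⁻¹)) (mdifferentiable_conj g)
    (x := (1 : G)) (y := 1) (by simp) X
  have h2 := mfderiv_comp_apply_congr_point (mdifferentiable_conj g) (hl h)
    (x := (1 : G)) (y := h) (by simp) X
  have h3 : (fun x => g * h * g⁻¹ * x) ∘ (fun h : G => g * h * g⁻¹) =
      (fun h : G => g * h * g⁻¹) ∘ (fun x => h * x) := by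
    funext x
    simp [mul_assoc]
  rw [h3] at h1
  exact h1.symm.trans h2

lemma mpullback_conj_mulInvariantVectorField (g : G) (X : GroupLieAlgebra (𝓡 m) G) :
    mpullback (𝓡 m) (𝓡 m) (fun h : G => g * h * g⁻¹) (mulInvariantVectorField (adjointMap m g X)) =
      mulInvariantVectorField X := by
  funext h
  rw [mpullback_apply, mulInvariantVectorField_adjointMap, inverse_mfderiv_conj_apply]

omit [LieGroup (𝓡 m) ∞ G] in
lemma mulInvariantVectorField_one (X : GroupLieAlgebra (𝓡 m) G) :
    mulInvariantVectorField X 1 = X := by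
  have h : ∀ f : G → G, f = id → (mfderiv (𝓡 m) (𝓡 m) f 1 X : EuclideanSpace ℝ (Fin m)) = X := by
    rintro _ rfl
    rw [mfderiv_id]
    rfl
  exact h _ (funext one_mul)

/-- Pullback along conjugation respects brackets of vector fields and takes the invariant field of
`Ad(g) X` to that of `X`; evaluation at the identity gives the claim. -/
lemma adjointMap_lie (g : G) (X Y : GroupLieAlgebra (𝓡 m) G) :
    adjointMap m g ⁅X, Y⁆ = ⁅adjointMap m g X, adjointMap m g Y⁆ := by
  have h1 := mpullback_mlieBracket (I := 𝓡 m) (I' := 𝓡 m) (n := minSmoothness ℝ 3)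
    (f := fun h : G => g * h * g⁻¹) (x₀ := 1)
    (mdifferentiableAt_mulInvariantVectorField (adjointMap m g X))
    (mdifferentiableAt_mulInvariantVectorField (adjointMap m g Y))
    ((contMDiff_conj g 1).of_le ENat.LEInfty.out) (minSmoothness_monotone (by norm_cast))
  rw [mpullback_conj_mulInvariantVectorField, mpullback_conj_mulInvariantVectorField,
    mpullback_apply, ← mulInvariantVector_mlieBracket] at h1
  have h2 : ∀ Z : GroupLieAlgebra (𝓡 m) G, adjointMap m g (adjointMap m g⁻¹ Z) = Z := fun Z => by
    simpa using adjointMap_inv_apply (m := m) g⁻¹ Z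
  set Z : GroupLieAlgebra (𝓡 m) G := mlieBracket (𝓡 m)
    (mulInvariantVectorField (adjointMap m g X)) (mulInvariantVectorField (adjointMap m g Y)) 1
    with hZ
  -- With `Z = Ad(g) Ad(g⁻¹) Z`, the inverse derivative in the pullback cancels.
  rw [← h2 Z, mulInvariantVectorField_adjointMap, inverse_mfderiv_conj_apply] at h1
  rw [GroupLieAlgebra.bracket_def, GroupLieAlgebra.bracket_def, ← hZ, ← h1,
    mulInvariantVectorField_one, h2]

variable (m) in
/-- The adjoint action is by automorphisms of the Lie algebra. -/
def adjointEquiv (g : G) : GroupLieAlgebra (𝓡 m) G ≃ₗ⁅ℝ⁆ GroupLieAlgebra (𝓡 m) G where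
  toLinearMap := adjointMap m g
  map_lie' := adjointMap_lie g _ _
  invFun := adjointMap m g⁻¹
  left_inv := adjointMap_inv_apply g
  right_inv X := by simpa using adjointMap_inv_apply (m := m) g⁻¹ X

lemma lieRep_adjointMap (hU : IsSmoothRep (m := m) U) (g : G) (X : GroupLieAlgebra (𝓡 m) G) :
    lieRep U (adjointMap m g X) = (U g : Matrix (Fin d) (Fin d) ℂ) * lieRep U X *
      (U g : Matrix (Fin d) (Fin d) ℂ).conjTranspose := by
  ext i j
  have h1 : HasDerivAt (fun t => ((fun h : G => (U h : Matrix (Fin d) (Fin d) ℂ) i j) ∘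
      (fun h : G => g * h * g⁻¹)) (chartCurve m X t)) (lieRep U (adjointMap m g X) i j) 0 := by
    have h2 := hasDerivAt_comp_chartCurve
      (((hU.mdifferentiable i j).comp (mdifferentiable_conj g)) 1) X
    exact h2.congr_deriv (mfderiv_comp_apply_congr_point (hU.mdifferentiable i j)
      (mdifferentiable_conj g) (by simp) X)
  refine h1.unique ?_
  have h3 : HasDerivAt (fun t => ∑ l, (∑ k, (U g : Matrix (Fin d) (Fin d) ℂ) i k *
      (U (chartCurve m X t) : Matrix (Fin d) (Fin d) ℂ) k l) *
        (U g : Matrix (Fin d) (Fin d) ℂ).conjTranspose l j)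
      (∑ l, (∑ k, (U g : Matrix (Fin d) (Fin d) ℂ) i k * lieRep U X k l) *
        (U g : Matrix (Fin d) (Fin d) ℂ).conjTranspose l j) 0 :=
    HasDerivAt.fun_sum fun l _ => (HasDerivAt.fun_sum fun k _ =>
      (hasDerivAt_comp_chartCurve (hU.mdifferentiable k l 1) X).const_mul _).mul_const _
  have h4 : ∀ t, ((fun h : G => (U h : Matrix (Fin d) (Fin d) ℂ) i j) ∘
      (fun h : G => g * h * g⁻¹)) (chartCurve m X t) =
      ∑ l, (∑ k, (U g : Matrix (Fin d) (Fin d) ℂ) i k *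
        (U (chartCurve m X t) : Matrix (Fin d) (Fin d) ℂ) k l) *
        (U g : Matrix (Fin d) (Fin d) ℂ).conjTranspose l j := fun t => by
    rw [Function.comp_apply, map_mul, map_mul, map_inv, Submonoid.coe_mul, Submonoid.coe_mul]
    rfl
  rw [funext h4]
  exact h3

/-! ### The Casimir operator -/

lemma IsKillingOrthonormal.map_adjoint {b : Module.Basis (Fin m) ℝ (GroupLieAlgebra (𝓡 m) G)}
    (hb : IsKillingOrthonormal b) (g : G) :
    IsKillingOrthonormal (b.map (adjointEquiv m g).toLinearEquiv) := by
  intro α β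
  rw [Module.Basis.map_apply, Module.Basis.map_apply, ← hb α β]
  exact LieAlgebra.killingForm_of_equiv_apply (adjointEquiv m g) _ _

/-- The change of basis `M` is orthogonal. `Mᵀ M = 1` comes from orthonormality, while the sum over
the basis uses `M Mᵀ = 1`. -/
lemma IsKillingOrthonormal.casimir_eq {b b' : Module.Basis (Fin m) ℝ (GroupLieAlgebra (𝓡 m) G)}
    (hb : IsKillingOrthonormal b) (hb' : IsKillingOrthonormal b') :
    casimir U b = casimir U b' := by
  set M := b.toMatrix b' with hM
  have hMb : ∀ β, b' β = ∑ α, M α β • b α := fun β => (b.sum_toMatrix_smul_self b' β).symm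
  have hMM : M.transpose * M = 1 := by
    ext β β'
    have h1 := hb' β β'
    simp only [hMb, map_sum, LinearMap.sum_apply, map_smul, LinearMap.smul_apply, smul_eq_mul,
      hb _ _] at h1
    rw [Matrix.mul_apply, Matrix.one_apply]
    simp only [mul_ite, mul_neg, mul_one, mul_zero, Finset.sum_ite_eq',
      Finset.mem_univ, if_true, Finset.sum_neg_distrib] at h1
    simp only [Matrix.transpose_apply]
    split_ifs at h1 ⊢ with h
    · rw [neg_inj] at h1; rw [← h1]; exact Finset.sum_congr rfl fun _ _ => mul_comm _ _
    · rw [neg_eq_zero] at h1; rw [← h1]; exact Finset.sum_congr rfl fun _ _ => mul_comm _ _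
  have hMM' : M * M.transpose = 1 := mul_eq_one_comm.1 hMM
  have hU' : ∀ β, lieRep U (b' β) = ∑ α, M α β • lieRep U (b α) := fun β => by
    rw [← lieRepLinear_apply, hMb, map_sum]
    simp only [map_smul, lieRepLinear_apply]
  rw [casimir, casimir, neg_inj]
  simp only [hU', Finset.sum_mul, Finset.mul_sum, Matrix.smul_mul, Matrix.mul_smul, smul_smul]
  symm
  rw [Finset.sum_comm]
  refine Finset.sum_congr rfl fun α _ => ?_
  rw [Finset.sum_comm]
  have h2 : ∀ α', ∑ β, M α β * M α' β = if α = α' then 1 else 0 := fun α' => by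
    rw [← Matrix.one_apply, ← hMM', Matrix.mul_apply]; rfl
  simp only [← Finset.sum_smul]
  simp only [h2, ite_smul, one_smul, zero_smul, Finset.sum_ite_eq, Finset.mem_univ, if_true]

lemma hasScalarCommutant_of_isIrreducible {G : Type*} [Monoid G]
    {U : G →* Matrix.unitaryGroup (Fin d) ℂ}
    (hU : (onSiteRep U).IsIrreducible) : HasScalarCommutant U := by
  intro R hR
  let f : (onSiteRep U).IntertwiningMap (onSiteRep U) :=
    ⟨Matrix.toLin' R, fun g => by
      change Matrix.toLin' R ∘ₗ Matrix.toLin' _ = Matrix.toLin' _ ∘ₗ Matrix.toLin' R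
      rw [← Matrix.toLin'_mul, ← Matrix.toLin'_mul]
      exact congrArg _ (hR g)⟩
  obtain ⟨c, hc⟩ :=
    Representation.IsIrreducible.algebraMap_intertwiningMap_bijective_of_isAlgClosed.2 f
  refine ⟨c, Matrix.toLin'.injective ?_⟩
  rw [map_smul, Matrix.toLin'_one]
  exact (congrArg Representation.IntertwiningMap.toLinearMap hc).symm

/-- Conjugation by `U g` replaces the basis by its image under `Ad(g)`, again orthonormal, so the
Casimir is unchanged. -/
lemma IsSmoothRep.casimir_mul_comm (hU : IsSmoothRep (m := m) U)
    {b : Module.Basis (Fin m) ℝ (GroupLieAlgebra (𝓡 m) G)} (hb : IsKillingOrthonormal b) (g : G) :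
    casimir U b * (U g : Matrix (Fin d) (Fin d) ℂ) =
      (U g : Matrix (Fin d) (Fin d) ℂ) * casimir U b := by
  set V := (U g : Matrix (Fin d) (Fin d) ℂ) with hV
  have hVV : V.conjTranspose * V = 1 := Matrix.mem_unitaryGroup_iff'.1 (U g).2
  have h1 : casimir U b = V * casimir U b * V.conjTranspose := by
    conv_lhs => rw [hb.casimir_eq (hb.map_adjoint g), casimir]
    rw [casimir, Matrix.mul_neg, Matrix.neg_mul, Finset.mul_sum, Finset.sum_mul]
    congr 1
    refine Finset.sum_congr rfl fun α _ => ?_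
    rw [Module.Basis.map_apply]
    change lieRep U (adjointMap m g (b α)) * lieRep U (adjointMap m g (b α)) = _
    rw [lieRep_adjointMap hU, ← hV]
    simp only [Matrix.mul_assoc]
    rw [← Matrix.mul_assoc V.conjTranspose V, hVV, Matrix.one_mul]
  conv_lhs => rw [h1, Matrix.mul_assoc, hVV, Matrix.mul_one]

end LieGroups

/-! ### The Casimir constant and the two-point function -/

section Correlators

open scoped ComplexOrder

variable {m d : ℕ} {G : Type*} [TopologicalSpace G] [ChartedSpace (EuclideanSpace ℝ (Fin m)) G]
  [Group G] [LieGroup (𝓡 m) ∞ G] {U : G →* Matrix.unitaryGroup (Fin d) ℂ}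

lemma card_sub_one_ne_zero {Λ : Type} [Fintype Λ] {x y : Λ} (hxy : x ≠ y) :
    (Fintype.card Λ : ℂ) - 1 ≠ 0 := by
  rw [sub_ne_zero, Nat.cast_ne_one]
  exact (Fintype.one_lt_card_iff.2 ⟨x, y, hxy⟩).ne'

omit [LieGroup (𝓡 m) ∞ G] in
lemma IsSmoothRep.trace_casimir (hU : IsSmoothRep (m := m) U)
    (b : Module.Basis (Fin m) ℝ (GroupLieAlgebra (𝓡 m) G)) :
    (casimir U b).trace = ∑ α, ((lieRep U (b α)).conjTranspose * lieRep U (b α)).trace := by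
  rw [casimir, Matrix.trace_neg, Matrix.trace_sum, ← Finset.sum_neg_distrib]
  refine Finset.sum_congr rfl fun α _ => ?_
  rw [(hU.isGenerator (b α)).conjTranspose_eq, Matrix.neg_mul, Matrix.trace_neg]

lemma IsSmoothRep.exists_casimir_eq (hU : IsSmoothRep (m := m) U)
    (hirr : (onSiteRep U).IsIrreducible) :
    ∃ c : ℝ, (∀ b : Module.Basis (Fin m) ℝ (GroupLieAlgebra (𝓡 m) G), IsKillingOrthonormal b →
        casimir U b = (c : ℂ) • (1 : Matrix (Fin d) (Fin d) ℂ)) ∧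
      (ConnectedSpace G → (∃ g, U g ≠ 1) → 0 < c) := by
  by_cases hb : ∃ b : Module.Basis (Fin m) ℝ (GroupLieAlgebra (𝓡 m) G), IsKillingOrthonormal b
  swap
  -- Without an orthonormal basis the scalar condition is vacuous, and any positive constant serves.
  · exact ⟨1, fun b h => absurd ⟨b, h⟩ hb, fun _ _ => one_pos⟩
  obtain ⟨b, hb⟩ := hb
  obtain ⟨z, hz⟩ := hasScalarCommutant_of_isIrreducible hirr _ (hU.casimir_mul_comm hb)
  have hd : (0 : ℝ) < d := by
    rw [Nat.cast_pos, Nat.pos_iff_ne_zero]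
    rintro rfl
    have hss : ∀ p q : Subrepresentation (onSiteRep U), p = q := fun p q =>
      Subrepresentation.toSubmodule_injective (Subsingleton.elim _ _)
    exact bot_ne_top (hss (⊥ : Subrepresentation (onSiteRep U)) ⊤)
  -- The trace equals `∑ ‖U(X_α)‖²` in the Hilbert–Schmidt norm: hence `z` is real and nonnegative,
  -- and zero only if the derivative of `U` vanishes.
  have htr : z * ((d : ℝ) : ℂ) =
      ∑ α, ((lieRep U (b α)).conjTranspose * lieRep U (b α)).trace := by
    rw [← hU.trace_casimir b, hz, Matrix.trace_smul, Matrix.trace_one, Fintype.card_fin,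
      smul_eq_mul, Complex.ofReal_natCast]
  have hterm : ∀ α ∈ Finset.univ,
      0 ≤ ((lieRep U (b α)).conjTranspose * lieRep U (b α)).trace := fun α _ =>
    (Matrix.posSemidef_conjTranspose_mul_self _).trace_nonneg
  have hnn : 0 ≤ z * ((d : ℝ) : ℂ) := by
    rw [htr]
    exact Finset.sum_nonneg hterm
  rw [Complex.nonneg_iff, Complex.re_mul_ofReal, Complex.im_mul_ofReal] at hnn
  have him : z = (z.re : ℂ) := Complex.ext rfl
    ((mul_eq_zero.1 hnn.2.symm).resolve_right hd.ne')
  refine ⟨z.re, fun b' hb' => by rw [← him, ← hz, hb'.casimir_eq hb], fun _ hne => ?_⟩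
  refine lt_of_le_of_ne (nonneg_of_mul_nonneg_left hnn.1 hd) fun h0 => ?_
  obtain ⟨X, hX⟩ := hU.exists_lieRep_ne_zero hne
  rw [him, ← h0, Complex.ofReal_zero, zero_mul] at htr
  have hzero : ∀ α, lieRep U (b α) = 0 := fun α =>
    Matrix.trace_conjTranspose_mul_self_eq_zero_iff.1
      ((Finset.sum_eq_zero_iff_of_nonneg hterm).1 htr.symm α (Finset.mem_univ α))
  refine hX ?_
  rw [← lieRepLinear_apply, show lieRepLinear m U = 0 from b.ext hzero, LinearMap.zero_apply]

omit [LieGroup (𝓡 m) ∞ G] in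
lemma IsSmoothRep.trace_mmis_mul_sum (hU : IsSmoothRep (m := m) U)
    {b : Module.Basis (Fin m) ℝ (GroupLieAlgebra (𝓡 m) G)} {c : ℂ}
    (hc : casimir U b = c • (1 : Matrix (Fin d) (Fin d) ℂ)) {Λ : Type} [Fintype Λ]
    [DecidableEq Λ] (hΛ : invariantSector U Λ ≠ ⊥) {x y : Λ} (hxy : x ≠ y) :
    (mmis U Λ * ∑ α, onSite x (lieRep U (b α)) * onSite y (lieRep U (b α))).trace =
      c / ((Fintype.card Λ : ℂ) - 1) := by
  rw [eq_div_iff (card_sub_one_ne_zero hxy), mul_comm, Matrix.mul_sum, Matrix.trace_sum,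
    Finset.mul_sum]
  have h : ∑ α, (mmis U Λ * onSite x (lieRep U (b α) * lieRep U (b α))).trace = -c := by
    rw [← Matrix.trace_sum, ← Matrix.mul_sum]
    simp only [← onSiteLinear_apply]
    rw [← map_sum, show ∑ α, lieRep U (b α) * lieRep U (b α) = -(c • 1) by
      rw [← hc, casimir, neg_neg], onSiteLinear_apply, ← neg_smul, onSite_smul, onSite_one,
      Matrix.mul_smul, Matrix.mul_one, Matrix.trace_smul, trace_mmis hΛ, smul_eq_mul, mul_one]
  rw [← neg_eq_iff_eq_neg.2 h, ← Finset.sum_neg_distrib]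
  exact Finset.sum_congr rfl fun α _ =>
    (hU.isGenerator (b α)).trace_mmis_mul_onSite_mul_onSite hxy

end Correlators

section SpinHalf

/-! ### Spin one half -/

lemma su2_mem {α β : ℂ} (h : α * star α + β * star β = 1) :
    !![α, β; -star β, star α] ∈ Matrix.specialUnitaryGroup (Fin 2) ℂ := by
  rw [Matrix.mem_specialUnitaryGroup_iff, Matrix.mem_unitaryGroup_iff]
  constructor
  · ext i j
    fin_cases i <;> fin_cases j <;>
      simp [Matrix.mul_apply, Fin.sum_univ_two, Matrix.star_apply] at h ⊢ <;>
      first | linear_combination h | ring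
  · rw [Matrix.det_fin_two_of]
    linear_combination h

/-- The elements of `SU(2)`. -/
def su2 (α β : ℂ) (h : α * star α + β * star β = 1) : Matrix.specialUnitaryGroup (Fin 2) ℂ :=
  ⟨!![α, β; -star β, star α], su2_mem h⟩

lemma coe_spinHalf (g : Matrix.specialUnitaryGroup (Fin 2) ℂ) :
    (spinHalf g : Matrix (Fin 2) (Fin 2) ℂ) = g := rfl

lemma isGenerator_spinHalf {α β : ℝ → ℂ} (h : ∀ t, α t * star (α t) + β t * star (β t) = 1)
    {α' β' : ℂ} (hα : HasDerivAt α α' 0) (hβ : HasDerivAt β β' 0) (hα0 : α 0 = 1)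
    (hβ0 : β 0 = 0) : IsGenerator spinHalf !![α', β'; -star β', star α'] := by
  refine ⟨fun t => su2 (α t) (β t) (h t), ?_, fun i j => ?_⟩
  · refine Subtype.ext ?_
    simp only [su2, hα0, hβ0, star_zero, neg_zero, star_one, OneMemClass.coe_one,
      Matrix.one_fin_two]
  · fin_cases i <;> fin_cases j
    · exact hα
    · exact hβ
    · exact hβ.star.neg
    · exact hα.star

/-- The curves are `exp(i t σ_a / 2)`; the factor `I` makes the Hermitian spin operators
anti-Hermitian. -/
lemma isGenerator_spin (a : Fin 3) : IsGenerator spinHalf (Complex.I • spin a) := by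
  have hcos : HasDerivAt (fun t : ℝ => ((Real.cos (t / 2) : ℝ) : ℂ)) 0 0 := by
    have := (((hasDerivAt_id (0 : ℝ)).div_const 2).cos).ofReal_comp
    simpa using this
  have hsin : HasDerivAt (fun t : ℝ => ((Real.sin (t / 2) : ℝ) : ℂ)) (1 / 2) 0 := by
    have := (((hasDerivAt_id (0 : ℝ)).div_const 2).sin).ofReal_comp
    simpa using this
  have hsq : ∀ t : ℝ, ((Real.cos (t / 2) : ℝ) : ℂ) ^ 2 + ((Real.sin (t / 2) : ℝ) : ℂ) ^ 2 = 1 :=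
    fun t => by exact_mod_cast Real.cos_sq_add_sin_sq (t / 2)
  fin_cases a
  · have h := isGenerator_spinHalf (α := fun t : ℝ => ((Real.cos (t / 2) : ℝ) : ℂ))
      (β := fun t : ℝ => Complex.I * ((Real.sin (t / 2) : ℝ) : ℂ))
      (fun t => by
        rw [← hsq t]
        simp only [star_mul', Complex.star_def, Complex.conj_ofReal, Complex.conj_I]
        linear_combination -((Real.sin (t / 2) : ℝ) : ℂ) ^ 2 * Complex.I_sq)
      hcos (hsin.const_mul Complex.I) (by simp) (by simp)
    convert h using 1
    ext i j
    fin_cases i <;> fin_cases j <;> simp [spin]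
  · have h := isGenerator_spinHalf (α := fun t : ℝ => ((Real.cos (t / 2) : ℝ) : ℂ))
      (β := fun t : ℝ => ((Real.sin (t / 2) : ℝ) : ℂ))
      (fun t => by
        rw [← hsq t]
        simp only [Complex.star_def, Complex.conj_ofReal]
        ring)
      hcos hsin (by simp) (by simp)
    convert h using 1
    ext i j
    fin_cases i <;> fin_cases j <;> simp [spin] <;>
      first | linear_combination (-1 / 2) * Complex.I_sq | linear_combination (1 / 2) * Complex.I_sq
  · have h := isGenerator_spinHalf
      (α := fun t : ℝ => ((Real.cos (t / 2) : ℝ) : ℂ) + Complex.I * ((Real.sin (t / 2) : ℝ) : ℂ))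
      (β := fun t : ℝ => 0)
      (fun t => by
        rw [← hsq t]
        simp only [star_add, star_mul', Complex.star_def, Complex.conj_ofReal, Complex.conj_I,
          zero_mul]
        linear_combination -((Real.sin (t / 2) : ℝ) : ℂ) ^ 2 * Complex.I_sq)
      (hcos.add (hsin.const_mul Complex.I)) (hasDerivAt_const _ _) (by simp) rfl
    convert h using 1
    ext i j
    fin_cases i <;> fin_cases j <;> simp [spin]

lemma spin_mul_self (a : Fin 3) : spin a * spin a = (1 / 4 : ℂ) • 1 := by
  fin_cases a <;> ext i j <;> fin_cases i <;> fin_cases j <;>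
    simp [spin, Matrix.mul_apply, Fin.sum_univ_two] <;> ring_nf <;> simp <;> norm_num

/-- Two elements suffice: `diag(i, -i)` kills the off-diagonal entries, and the rotation `!![0, 1;
-1, 0]` equates the diagonal ones. -/
lemma hasScalarCommutant_spinHalf : HasScalarCommutant spinHalf := by
  intro R hR
  have h1 := hR (su2 Complex.I 0 (by simp))
  have h2 := hR (su2 0 1 (by simp))
  rw [coe_spinHalf] at h1 h2
  have h01 : R 0 1 = 0 := by
    have := congrFun (congrFun h1 0) 1
    simp [su2, Matrix.mul_apply, Fin.sum_univ_two] at this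
    have h3 : 2 * Complex.I * R 0 1 = 0 := by linear_combination -this
    simpa using h3
  have h10 : R 1 0 = 0 := by
    have := congrFun (congrFun h1 1) 0
    simp [su2, Matrix.mul_apply, Fin.sum_univ_two] at this
    have h3 : 2 * Complex.I * R 1 0 = 0 := by linear_combination this
    simpa using h3
  have h00 : R 0 0 = R 1 1 := by
    have := congrFun (congrFun h2 0) 1
    simpa [su2, Matrix.mul_apply, Fin.sum_univ_two] using this
  refine ⟨R 0 0, ?_⟩
  ext i j
  fin_cases i <;> fin_cases j <;> simp [h01, h10, h00]

lemma isLongRangeEntangled_spinHalf : IsLongRangeEntangled spinHalf := by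
  refine isLongRangeEntangled_of_generator hasScalarCommutant_spinHalf (isGenerator_spin 0)
    fun h => ?_
  have := congrFun (congrFun h 0) 1
  simp [spin] at this

/-- The wave function of the two-site singlet. -/
def singlet (q : Fin 2 → Fin 2) : ℂ := (!![0, 1; -1, 0] : Matrix (Fin 2) (Fin 2) ℂ) (q 0) (q 1)

/-- This is `V ε Vᵀ = det V • ε` for the antisymmetric `2 × 2` matrix `ε`. -/
lemma sum_mul_singlet {V : Matrix (Fin 2) (Fin 2) ℂ} (hV : V.det = 1) (q : Fin 2 → Fin 2) :
    ∑ p : Fin 2 → Fin 2, (∏ k, V (q k) (p k)) * singlet p = singlet q := by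
  rw [Matrix.det_fin_two] at hV
  rw [← (finTwoArrowEquiv (Fin 2)).symm.sum_comp, Fintype.sum_prod_type]
  simp only [singlet, Fin.prod_univ_two, Fin.sum_univ_two]
  generalize q 0 = i
  generalize q 1 = j
  fin_cases i <;> fin_cases j <;> simp [finTwoArrowEquiv] <;>
    first | linear_combination hV | linear_combination -hV | ring

/-- Group the sites into pairs and put a singlet on each pair. -/
lemma invariantSector_spinHalf_ne_bot {Λ : Type} [Fintype Λ] [DecidableEq Λ]
    (hΛ : Even (Fintype.card Λ)) : invariantSector spinHalf Λ ≠ ⊥ := by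
  obtain ⟨n, hn⟩ := hΛ
  have e : Λ ≃ Fin n × Fin 2 := Fintype.equivOfCardEq (by simp [hn, mul_two])
  let E : (Λ → Fin 2) ≃ (Fin n → Fin 2 → Fin 2) :=
    (e.arrowCongr (Equiv.refl _)).trans (Equiv.curry _ _ _)
  have hE : ∀ s i k, E s i k = s (e.symm (i, k)) := fun _ _ _ => rfl
  let ψ : EuclideanSpace ℂ (Λ → Fin 2) := WithLp.toLp 2 fun s => ∏ i, singlet (E s i)
  have hψ : ψ ∈ invariantSector spinHalf Λ := by
    intro g
    have hdet : (g : Matrix (Fin 2) (Fin 2) ℂ).det = 1 :=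
      (Matrix.mem_specialUnitaryGroup_iff.1 g.2).2
    funext s
    rw [coe_spinHalf]
    set V := (g : Matrix (Fin 2) (Fin 2) ℂ)
    change ∑ t, (∏ x, V (s x) (t x)) * ∏ i, singlet (E t i) = ∏ i, singlet (E s i)
    have h1 : ∀ t : Λ → Fin 2, ∏ x, V (s x) (t x) = ∏ i, ∏ k, V (E s i k) (E t i k) := fun t => by
      rw [← e.symm.prod_comp, Fintype.prod_prod_type]
      rfl
    simp only [h1, ← Finset.prod_mul_distrib]
    rw [E.sum_comp fun p : Fin n → Fin 2 → Fin 2 =>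
      ∏ i, ((∏ k, V (E s i k) (p i k)) * singlet (p i))]
    have h2 := Finset.prod_univ_sum (fun _ : Fin n => (Finset.univ : Finset (Fin 2 → Fin 2)))
      fun i p => (∏ k, V (E s i k) (p k)) * singlet p
    rw [Fintype.piFinset_univ] at h2
    rw [← h2]
    exact Finset.prod_congr rfl fun i _ => sum_mul_singlet hdet _
  intro hbot
  rw [hbot, Submodule.mem_bot] at hψ
  -- In the configuration `01` on every pair, the amplitude is `1`.
  have h0 := congrFun (congrArg WithLp.ofLp hψ) fun x => (e x).2
  have h1 : ∏ i, singlet (E (fun x => (e x).2) i) = 1 := Finset.prod_eq_one fun i _ => by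
    simp [singlet, hE]
  exact one_ne_zero (h1.symm.trans h0)

lemma trace_mmis_spinHalf_mul_spin {Λ : Type} [Fintype Λ] [DecidableEq Λ] (x : Λ) (a : Fin 3) :
    (mmis spinHalf Λ * onSite x (spin a)).trace = 0 := by
  have := (isGenerator_spin a).trace_mmis_mul_onSite x
  rw [onSite_smul, Matrix.mul_smul, Matrix.trace_smul, smul_eq_mul] at this
  exact (mul_eq_zero.1 this).resolve_left Complex.I_ne_zero

lemma trace_mmis_spinHalf_mul_spin_mul_spin {Λ : Type} [Fintype Λ] [DecidableEq Λ]
    (hΛ : Even (Fintype.card Λ)) {x y : Λ} (hxy : x ≠ y) :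
    (mmis spinHalf Λ * ∑ a, onSite x (spin a) * onSite y (spin a)).trace =
      -(3 / (4 * ((Fintype.card Λ : ℂ) - 1))) := by
  have hN := card_sub_one_ne_zero hxy
  have h : ∀ a, (mmis spinHalf Λ * (onSite x (spin a) * onSite y (spin a))).trace =
      -(1 / (4 * ((Fintype.card Λ : ℂ) - 1))) := fun a => by
    -- Both sides of the sum rule carry `I² = -1`, and `spin a` squares to `1/4`; the three
    -- components then add up to `3/4`.
    have h1 := (isGenerator_spin a).trace_mmis_mul_onSite_mul_onSite hxy
    rw [onSite_smul, onSite_smul, smul_mul_smul_comm, smul_mul_smul_comm, Complex.I_mul_I,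
      spin_mul_self, onSite_smul, onSite_smul, onSite_one, Matrix.mul_smul, Matrix.mul_smul,
      Matrix.mul_smul, Matrix.mul_one, Matrix.trace_smul, Matrix.trace_smul, Matrix.trace_smul,
      trace_mmis (invariantSector_spinHalf_ne_bot hΛ)] at h1
    simp only [smul_eq_mul] at h1
    field_simp
    linear_combination -4 * h1
  rw [Matrix.mul_sum, Matrix.trace_sum, Finset.sum_congr rfl fun a _ => h a, Finset.sum_const,
    Finset.card_univ, Fintype.card_fin, nsmul_eq_mul]
  push_cast
  ring

end SpinHalf

end MMIS

end

theorem mainTheorem6 :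
    (∀ (m d : ℕ) (G : Type*) [Group G] [TopologicalSpace G] [T2Space G] [CompactSpace G]
        [ChartedSpace (EuclideanSpace ℝ (Fin m)) G] [LieGroup (𝓡 m) ∞ G]
        [LieAlgebra.IsSemisimple ℝ (GroupLieAlgebra (𝓡 m) G)]
        (U : G →* Matrix.unitaryGroup (Fin d) ℂ), MMIS.IsSmoothRep (m := m) U →
        (MMIS.onSiteRep U).IsIrreducible →
      (∃ c : ℝ,
        (∀ b : Module.Basis (Fin m) ℝ (GroupLieAlgebra (𝓡 m) G), MMIS.IsKillingOrthonormal b →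
          MMIS.casimir U b = (c : ℂ) • (1 : Matrix (Fin d) (Fin d) ℂ) ∧
          ∀ (Λ : Type) [Fintype Λ] [DecidableEq Λ], MMIS.invariantSector U Λ ≠ ⊥ →
            ∀ x y : Λ, x ≠ y →
              -(MMIS.mmis U Λ * ∑ α, MMIS.onSite x (MMIS.lieRep U (b α)) *
                  MMIS.onSite y (MMIS.lieRep U (b α))).trace
                = -((c : ℂ) / ((Fintype.card Λ : ℂ) - 1))) ∧
        (ConnectedSpace G → (∃ g, U g ≠ 1) → 0 < c)) ∧
      (∀ (Λ : Type) [Fintype Λ] [DecidableEq Λ], MMIS.invariantSector U Λ ≠ ⊥ →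
        ∀ (x : Λ) (X : GroupLieAlgebra (𝓡 m) G),
          (MMIS.mmis U Λ * MMIS.onSite x (MMIS.lieRep U X)).trace = 0) ∧
      (ConnectedSpace G → (∃ g, U g ≠ 1) → MMIS.IsLongRangeEntangled U)) ∧
    (∀ (Λ : Type) [Fintype Λ] [DecidableEq Λ], Even (Fintype.card Λ) →
      (∀ x y : Λ, x ≠ y →
        (MMIS.mmis MMIS.spinHalf Λ *
            ∑ a, MMIS.onSite x (MMIS.spin a) * MMIS.onSite y (MMIS.spin a)).trace
          = -(3 / (4 * ((Fintype.card Λ : ℂ) - 1)))) ∧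
      (∀ (x : Λ) (a : Fin 3),
        (MMIS.mmis MMIS.spinHalf Λ * MMIS.onSite x (MMIS.spin a)).trace = 0)) ∧
    MMIS.IsLongRangeEntangled MMIS.spinHalf := by
  refine ⟨fun m d G _ _ _ _ _ _ _ U hU hirr => ⟨?_, ?_, ?_⟩, fun Λ _ _ hΛ => ⟨?_, ?_⟩,
    MMIS.isLongRangeEntangled_spinHalf⟩
  · obtain ⟨c, hc, hpos⟩ := hU.exists_casimir_eq hirr
    exact ⟨c, fun b hb => ⟨hc b hb, fun Λ _ _ hΛ x y hxy => by
      rw [hU.trace_mmis_mul_sum (hc b hb) hΛ hxy]⟩, hpos⟩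
  · exact fun Λ _ _ _ x X => (hU.isGenerator X).trace_mmis_mul_onSite x
  · intro _ hne
    obtain ⟨X, hX⟩ := hU.exists_lieRep_ne_zero hne
    exact MMIS.isLongRangeEntangled_of_generator
      (MMIS.hasScalarCommutant_of_isIrreducible hirr) (hU.isGenerator X) hX
  · exact fun x y hxy => MMIS.trace_mmis_spinHalf_mul_spin_mul_spin hΛ hxy
  · exact fun x a => MMIS.trace_mmis_spinHalf_mul_spin x a
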